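/- All tournaments are finite. A tournament is a loopless digraph with exactly one arc between any two distinct vertices. For a tournament $T$ and a total order $<$ of $V(T)$, the backedge graph of $T$ with respect to $<$ is the undirected graph on $V(T)$ with edge set $\{uv : u < v,\ vu \in A(T)\}$. The clique number $\overrightarrow{\omega}(T)$ of $T$ is the minimum, over all total orders of $V(T)$, of the (usual) clique number of the corresponding backedge graph. A subtournament is an induced subdigraph, considered up to isomorphism. For a set $\mathcal{H}$ of tournaments, a tournament is $\mathcal{H}$-free if no member of $\mathcal{H}$ is a subtournament of it. For disjoint vertex sets $X, Y$ (or single vertices), $X \Rightarrow Y$ means that $xy$ is an arc for all $x \in X$, $y \in Y$. The tournaments $A_n$ and $D_n$ ($n \ge 1$) are defined as follows. $A_1$ and $D_1$ are single vertices. For $n \ge 2$, $A_n$ consists of disjoint copies $T_1, \dots, T_{n-1}$ of $A_{n-1}$ and $n$ further vertices $v_1, \dots, v_n$, with $v_j \Rightarrow v_i$ for $1 \le i < j \le n$; $V(T_i) \Rightarrow V(T_j)$ for $1 \le i < j \le n-1$; and, for $1 \le i \le n$ and $1 \le j \le n-1$, $v_i \Rightarrow V(T_j)$ if $i \le j$ and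 $V(T_j) \Rightarrow v_i$ if $i > j$. For $n \ge 2$, $D_n$ consists of two disjoint copies $T_1, T_2$ of $D_{n-1}$ and one further vertex $v$, with $V(T_1) \Rightarrow V(T_2)$, $V(T_2) \Rightarrow v$ and $v \Rightarrow V(T_1)$. **Theorem.** Let $\mathcal{H}$ be a (finite or infinite) set of tournaments. Then there is a constant $c$ such that $\overrightarrow{\omega}(T) \le c$ for every $\mathcal{H}$-free tournament $T$ if and only if there is an integer $n \ge 1$ such that $\mathcal{H}$ contains a subtournament of $A_n$ and $\mathcal{H}$ contains a subtournament of $D_n$. -/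

import Mathlib

universe u v

namespace Digraph

/-- No loops, and exactly one of the two possible arcs between any two distinct vertices. -/
structure IsTournament {V : Type u} (G : Digraph V) : Prop where
  loopless : ∀ x, ¬ G.Adj x x
  exactly_one : ∀ x y, x ≠ y → (G.Adj x y ↔ ¬ G.Adj y x)

/-- The (undirected) backedge graph of `G` with respect to the total order `L`: its edges are the
pairs `xy` such that `x` precedes `y` and `yx` is an arc of `G`. -/
def backedgeGraph {V : Type u} (G : Digraph V) (L : LinearOrder V) : SimpleGraph V where
  Adj x y := (L.lt x y ∧ G.Adj y x) ∨ (L.lt y x ∧ G.Adj x y)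
  symm := ⟨fun _ _ h => h.symm⟩
  loopless := ⟨fun x h => h.elim (fun h => lt_irrefl x h.1) (fun h => lt_irrefl x h.1)⟩

/-- The minimum, over all total orders of the vertex set, of the clique number of the backedge
graph. (Every type has a total order, so this is the minimum of a nonempty set of naturals.) -/
noncomputable def backedgeCliqueNum {V : Type u} (G : Digraph V) : ℕ :=
  sInf {k : ℕ | ∃ L : LinearOrder V, (G.backedgeGraph L).cliqueNum = k}

end Digraph

/-- A finite tournament (possibly with no vertices). -/
structure Tournament : Type (u + 1) where
  Vert : Type u
  finite_vert : Finite Vert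
  graph : Digraph Vert
  isTournament : graph.IsTournament

namespace Tournament

/-- The clique number of a tournament. -/
noncomputable def cliqueNumber (T : Tournament.{u}) : ℕ := T.graph.backedgeCliqueNum

/-- `S` is (isomorphic to) a subtournament of `T`, i.e. some injection of the vertex set of `S`
into that of `T` preserves and reflects arcs. -/
def IsSubtournament (S : Tournament.{u}) (T : Tournament.{v}) : Prop :=
  ∃ f : S.Vert ↪ T.Vert, ∀ x y, T.graph.Adj (f x) (f y) ↔ S.graph.Adj x y

/-- `T` is `H`-free: no member of `H` is a subtournament of `T`. -/
def IsFree (T : Tournament.{v}) (H : Set Tournament.{u}) : Prop :=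
  ∀ S ∈ H, ¬ S.IsSubtournament T

/-- The tournament without vertices. -/
def empty : Tournament.{0} where
  Vert := Empty
  finite_vert := inferInstance
  graph := ⟨fun _ _ => False⟩
  isTournament := ⟨fun x => x.elim, fun x => x.elim⟩

/-- The tournament with a single vertex. -/
def single : Tournament.{0} where
  Vert := Unit
  finite_vert := inferInstance
  graph := ⟨fun _ _ => False⟩
  isTournament := ⟨fun _ h => h, fun x y h => (h (Subsingleton.elim x y)).elim⟩

/-- The arcs of `Δ(R, S, T)`: those of the disjoint tournaments `R`, `S`, `T`, together with all
arcs from `R` to `S`, from `S` to `T`, and from `T` to `R`. -/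
def deltaAdj (R S T : Tournament.{u}) :
    R.Vert ⊕ S.Vert ⊕ T.Vert → R.Vert ⊕ S.Vert ⊕ T.Vert → Prop
  | .inl x, .inl y => R.graph.Adj x y
  | .inr (.inl x), .inr (.inl y) => S.graph.Adj x y
  | .inr (.inr x), .inr (.inr y) => T.graph.Adj x y
  | .inl _, .inr (.inl _) => True
  | .inr (.inl _), .inr (.inr _) => True
  | .inr (.inr _), .inl _ => True
  | .inr (.inl _), .inl _ => False
  | .inr (.inr _), .inr (.inl _) => False
  | .inl _, .inr (.inr _) => False

/-- The tournament `Δ(R, S, T)`. -/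
def delta (R S T : Tournament.{u}) : Tournament.{u} where
  Vert := R.Vert ⊕ S.Vert ⊕ T.Vert
  finite_vert := by
    have := R.finite_vert
    have := S.finite_vert
    have := T.finite_vert
    infer_instance
  graph := ⟨deltaAdj R S T⟩
  isTournament := by
    constructor
    · rintro (x | x | x)
      · exact R.isTournament.loopless x
      · exact S.isTournament.loopless x
      · exact T.isTournament.loopless x
    · rintro (x | x | x) (y | y | y) h
      · exact R.isTournament.exactly_one x y (fun e => h (by rw [e]))
      · simp [deltaAdj]
      · simp [deltaAdj]
      · simp [deltaAdj]
      · exact S.isTournament.exactly_one x y (fun e => h (by rw [e]))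
      · simp [deltaAdj]
      · simp [deltaAdj]
      · simp [deltaAdj]
      · exact T.isTournament.exactly_one x y (fun e => h (by rw [e]))

/-- The arcs of the tournament built from `n` disjoint copies `T_0, …, T_{n-1}` of `T` (vertices
`.inl (i, x)`, where `i` is the index of the copy) and `n + 1` further vertices `v_0, …, v_n`
(vertices `.inr i`): arcs inside a copy are those of `T`; `T_i ⇒ T_j` if `i < j`; `v_i ⇒ T_j` if
`i ≤ j`; `T_j ⇒ v_i` if `j < i`; and `v_j → v_i` if `i < j`. -/
def interleaveAdj (n : ℕ) (T : Tournament.{u}) :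
    (Fin n × T.Vert) ⊕ Fin (n + 1) → (Fin n × T.Vert) ⊕ Fin (n + 1) → Prop
  | .inl (i, x), .inl (j, y) => i < j ∨ (i = j ∧ T.graph.Adj x y)
  | .inr i, .inl (j, _) => (i : ℕ) ≤ (j : ℕ)
  | .inl (j, _), .inr i => (j : ℕ) < (i : ℕ)
  | .inr j, .inr i => i < j

/-- The tournament with the arcs `interleaveAdj n T`. -/
def interleave (n : ℕ) (T : Tournament.{u}) : Tournament.{u} where
  Vert := (Fin n × T.Vert) ⊕ Fin (n + 1)
  finite_vert := by
    have := T.finite_vert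
    infer_instance
  graph := ⟨interleaveAdj n T⟩
  isTournament := by
    constructor
    · rintro (⟨i, x⟩ | i)
      · simpa [interleaveAdj] using T.isTournament.loopless x
      · simp [interleaveAdj]
    · rintro (⟨i, x⟩ | i) (⟨j, y⟩ | j) h
      · rcases lt_trichotomy i j with hij | rfl | hij
        · simp [interleaveAdj, hij, hij.ne', hij.not_gt]
        · simpa [interleaveAdj] using T.isTournament.exactly_one x y (fun e => h (by rw [e]))
        · simp [interleaveAdj, hij, hij.ne', hij.not_gt]
      · simp only [interleaveAdj]
        omega
      · simp only [interleaveAdj]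
        omega
      · have hij : i ≠ j := fun e => h (by rw [e])
        simp only [interleaveAdj]
        omega

/-- The tournament `A_n`, built from `n - 1` copies of `A_{n-1}` and `n` further vertices. The
recursion starts at the empty tournament `A_0`, so that `A_1` (no copies and one further vertex)
is a single vertex. -/
def A : ℕ → Tournament.{0}
  | 0 => empty
  | n + 1 => interleave n (A n)

/-- The tournament `D_n = Δ(D_{n-1}, D_{n-1}, D_1)`. The recursion starts at the empty tournament
`D_0`, so that `D_1` is a single vertex. -/
def D : ℕ → Tournament.{0}
  | 0 => empty
  | n + 1 => delta (D n) (D n) single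

end Tournament

/-!
For a set `X` of vertices of a tournament with arc relation `R`, `Le R X k` says that `X` has clique
number at most `k`. This is monotone, subadditive in `X`, and invariant under reversal of all arcs.

**Lower bounds.** Both `A n` and `D n` have unbounded clique number, by Ramsey arguments. Copies of
`D n` satisfy a Ramsey property for two-part partitions of the vertex set (`Dp.of_union`), and so do
mountains (`Mtn.of_union`), of which the `A n` are examples (`Ap.mtn`): for an arc `u → v` of a
mountain, the vertices completing it to a cyclic triangle form a mountain of smaller height. Given a
ranking, one side of a well-chosen vertex contains a large part of a smaller copy or mountain, and
induction gives large backedge cliques. So if the `H`-free tournaments have clique number at most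
`c`, then `A n` and `D n` with `n = 2 ^ (c + 1) - 1` are not `H`-free.

**Upper bound.** It remains to bound the clique number of sets without `D n` and without `A m`
(`exists_bound`). A chain is a sequence of bags, sets of large clique number, in which every
vertex of a bag is complete to all later bags and complete from all earlier ones, up to sets of
clique number at most a constant `κ`.

*Chains exist* (`exists_chain`). Suppose that sets of large clique number contain `r`-mountains but
that there is no `(r + 1)`-mountain. Call an arc heavy if the vertices completing it to a cyclic
triangle contain an `r`-mountain. There are no `r + 1` vertices pairwise joined by heavy arcs.
By a local-to-global argument (`Blocks.le_of_out`), a set of large clique number without large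
heavy cliques has a vertex `x` whose in- and out-neighbourhood both have large clique number. Apart
from the heavy neighbours of `x`, which are dealt with by induction, every arc at `x` is in
cyclic triangles with only a set of small clique number, which means that the in-neighbourhood of
`x` is loosely complete to the out-neighbourhood. Repeated splitting gives a chain. If, on the other
hand, there are `r`-mountains for all `r`, then some bounded set `S` has large clique number, and
the vertices can be partitioned according to their arcs to `S`; this again splits off a bag.

*From chains to copies of `A m`* (`exists_bound_step`). Let `X` contain no `D (n + 1)`, while its
subsets of clique number more than `k` contain both `D n` and `A m`. Then there are no vertex
`v` and large sets `A`, `B` with arcs from `v` to `A` and from `B` to `v` such that `A` is loosely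
complete to `B` (`NoD.false_of_in`, `NoD.false_of_out`). This has two consequences. The looseness
of any chain can be brought down to `k` by omitting every other bag (`NoD.loose`); and with respect
to a longest `k`-loose chain, each vertex `v` has a position such that `v` is loosely complete from
the bags before it and loosely complete to those after it (`LongChain.le_inN`). The vertices of a
given position have bounded clique number, since otherwise they would contain four bags that could
replace at most three bags of the longest chain (`LongChain.not_hasChain`). Hence if the clique
number of `X` is large, a ranking compatible with the positions has a backedge clique of many
vertices at pairwise distant positions. These vertices, together with copies of `A m` selected
from the bags between them, form a copy of `A (m + 1)` (`LongChain.ap_succ`).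
-/

namespace TournamentClique

open scoped Classical

variable {V : Type u}

/-! ### The clique number of a set of vertices -/

/-- `R` is the arc relation of a tournament. -/
structure IsTour (R : V → V → Prop) : Prop where
  irrefl : ∀ x, ¬ R x x
  total : ∀ x y, x ≠ y → (R x y ↔ ¬ R y x)

theorem IsTour.asymm {R : V → V → Prop} (hR : IsTour R) {x y : V} (h : R x y) : ¬ R y x := by
  rcases eq_or_ne x y with rfl | hne
  · exact hR.irrefl x
  · exact (hR.total x y hne).1 h

theorem IsTour.ne {R : V → V → Prop} (hR : IsTour R) {x y : V} (h : R x y) : x ≠ y := by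
  rintro rfl
  exact hR.irrefl x h

theorem IsTour.of_not {R : V → V → Prop} (hR : IsTour R) {x y : V} (hne : x ≠ y) (h : ¬ R x y) :
    R y x :=
  (hR.total y x hne.symm).2 h

theorem IsTour.flip {R : V → V → Prop} (hR : IsTour R) : IsTour (flip R) :=
  ⟨hR.irrefl, fun x y h => hR.total y x h.symm⟩

/-- `K` is a clique of the backedge graph of `R` with respect to the ranking `ρ`. -/
def BackClique (R : V → V → Prop) (ρ : V → ℕ) (K : Finset V) : Prop :=
  ∀ x ∈ K, ∀ y ∈ K, ρ x < ρ y → R y x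

theorem BackClique.subset {R : V → V → Prop} {ρ : V → ℕ} {K K' : Finset V}
    (h : BackClique R ρ K) (hs : K' ⊆ K) : BackClique R ρ K' :=
  fun x hx y hy => h x (hs hx) y (hs hy)

/-- The subtournament of `R` induced on `X` has clique number at most `k`: some ranking of `X`,
injective on `X`, has all its backedge cliques of size at most `k`. -/
def Le (R : V → V → Prop) (X : Finset V) (k : ℕ) : Prop :=
  ∃ ρ : V → ℕ, Set.InjOn ρ X ∧ ∀ K ⊆ X, BackClique R ρ K → K.card ≤ k

/-- The out-neighbours of `v` in `X`. -/
noncomputable def outN (R : V → V → Prop) (v : V) (X : Finset V) : Finset V := X.filter (R v)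

/-- The in-neighbours of `v` in `X`. -/
noncomputable def inN (R : V → V → Prop) (v : V) (X : Finset V) : Finset V :=
  X.filter (fun w => R w v)

section Basic

variable {R : V → V → Prop} {X Y : Finset V} {k l : ℕ} {v w : V}

@[simp] theorem mem_outN : w ∈ outN R v X ↔ w ∈ X ∧ R v w := Finset.mem_filter

@[simp] theorem mem_inN : w ∈ inN R v X ↔ w ∈ X ∧ R w v := Finset.mem_filter

theorem outN_subset : outN R v X ⊆ X := Finset.filter_subset _ _

theorem inN_subset : inN R v X ⊆ X := Finset.filter_subset _ _

theorem outN_mono (h : Y ⊆ X) : outN R v Y ⊆ outN R v X := Finset.filter_subset_filter _ h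

theorem inN_mono (h : Y ⊆ X) : inN R v Y ⊆ inN R v X := Finset.filter_subset_filter _ h

theorem Le.mono (h : Le R X k) (hY : Y ⊆ X) (hk : k ≤ l) : Le R Y l := by
  obtain ⟨ρ, hi, hρ⟩ := h
  exact ⟨ρ, hi.mono (by exact_mod_cast hY), fun K hK hc => (hρ K (hK.trans hY) hc).trans hk⟩

theorem Le.subset (h : Le R X k) (hY : Y ⊆ X) : Le R Y k := h.mono hY le_rfl

theorem Le.le (h : Le R X k) (hk : k ≤ l) : Le R X l := h.mono subset_rfl hk

theorem le_empty : Le R ∅ k :=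
  ⟨fun _ => 0, by simp, fun K hK _ => by simp [Finset.subset_empty.1 hK]⟩

theorem Le.union (hX : Le R X k) (hY : Le R Y l) : Le R (X ∪ Y) (k + l) := by
  obtain ⟨ρ, hi, hρ⟩ := hX
  obtain ⟨σ, hj, hσ⟩ := hY
  -- The ranking of `Y ∖ X` is placed after that of `X`.
  obtain ⟨B, hB⟩ : ∃ B, ∀ x ∈ X, ρ x < B :=
    ⟨X.sup ρ + 1, fun x hx => Nat.lt_succ_of_le (Finset.le_sup hx)⟩
  refine ⟨fun v => if v ∈ X then ρ v else B + σ v, ?_, fun K hK hc => ?_⟩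
  · intro x hx y hy hxy
    simp only [Finset.coe_union, Set.mem_union, Finset.mem_coe] at hx hy
    by_cases h1 : x ∈ X <;> by_cases h2 : y ∈ X
    · simp only [h1, h2, if_true] at hxy
      exact hi h1 h2 hxy
    · simp only [h1, h2, if_true, if_false] at hxy
      have := hB x h1
      omega
    · simp only [h1, h2, if_true, if_false] at hxy
      have := hB y h2
      omega
    · simp only [h1, h2, if_false] at hxy
      exact hj (hx.resolve_left h1) (hy.resolve_left h2) (by omega)
  · have h1 : (K.filter (· ∈ X)).card ≤ k := by
      refine hρ _ (fun x hx => (Finset.mem_filter.1 hx).2) fun x hx y hy hxy => ?_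
      rw [Finset.mem_filter] at hx hy
      exact hc x hx.1 y hy.1 (by simpa [hx.2, hy.2] using hxy)
    have h2 : (K.filter (· ∉ X)).card ≤ l := by
      refine hσ _ (fun x hx => ?_) fun x hx y hy hxy => ?_
      · rw [Finset.mem_filter] at hx
        exact (Finset.mem_union.1 (hK hx.1)).resolve_left hx.2
      · rw [Finset.mem_filter] at hx hy
        exact hc x hx.1 y hy.1 (by simpa [hx.2, hy.2] using hxy)
    rw [← Finset.card_filter_add_card_filter_not (· ∈ X)]
    omega

theorem Le.of_union (h : ¬ Le R (X ∪ Y) (k + l)) : ¬ Le R X k ∨ ¬ Le R Y l := by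
  by_contra! hh
  exact h (hh.1.union hh.2)

theorem le_card : Le R X X.card := by
  obtain ⟨e⟩ : Nonempty (X ≃ Fin X.card) := ⟨X.equivFin⟩
  refine ⟨fun v => if h : v ∈ X then e ⟨v, h⟩ else 0, ?_, fun K hK _ => Finset.card_le_card hK⟩
  intro x hx y hy hxy
  have hx' : x ∈ X := hx
  have hy' : y ∈ X := hy
  simp only [hx', hy', dif_pos] at hxy
  simpa using e.injective (Fin.ext hxy)

/-- Reversing all arcs does not change the clique number: reverse the ranking as well. -/
theorem Le.flip (h : Le R X k) : Le (flip R) X k := by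
  obtain ⟨ρ, hi, hρ⟩ := h
  obtain ⟨B, hB⟩ : ∃ B, ∀ x ∈ X, ρ x ≤ B := ⟨X.sup ρ, fun x hx => Finset.le_sup hx⟩
  refine ⟨fun v => B - ρ v, fun x hx y hy hxy => hi hx hy ?_, fun K hK hc => hρ K hK ?_⟩
  · have := hB x hx
    have := hB y hy
    simp only at hxy
    omega
  · intro x hx y hy hxy
    have h1 := hB x (hK hx)
    have h2 := hB y (hK hy)
    exact hc y hy x hx (show B - ρ y < B - ρ x by omega)

theorem le_flip : Le (flip R) X k ↔ Le R X k := ⟨fun h => h.flip, fun h => h.flip⟩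

theorem le_biUnion {ι : Type*} (I : Finset ι) (f : ι → Finset V) (h : ∀ i ∈ I, Le R (f i) k) :
    Le R (I.biUnion f) (I.card * k) := by
  induction I using Finset.induction_on with
  | empty => simpa using le_empty
  | insert i I hi ih =>
    rw [Finset.biUnion_insert, Finset.card_insert_of_notMem hi]
    refine ((h i (by simp)).union (ih fun j hj => h j (by simp [hj]))).le ?_
    rw [Nat.succ_mul, Nat.add_comm]

theorem le_of_fibres {ι : Type*} (I : Finset ι) (f : V → ι) (hf : ∀ x ∈ X, f x ∈ I)
    (h : ∀ i ∈ I, Le R (X.filter (f · = i)) k) : Le R X (I.card * k) :=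
  (le_biUnion I _ h).subset fun x hx => by
    simp only [Finset.mem_biUnion, Finset.mem_filter]
    exact ⟨f x, hf x hx, hx, rfl⟩

/-- The clique number grows by at most one when a vertex is added, so it takes all values. -/
theorem exists_subset_le (h : ¬ Le R X k) : ∃ Y ⊆ X, ¬ Le R Y k ∧ Le R Y (k + 1) := by
  induction X using Finset.induction_on with
  | empty => exact (h le_empty).elim
  | insert x X hx ih =>
    by_cases hX : Le R X k
    · refine ⟨_, subset_rfl, h, ?_⟩
      have := (le_card (R := R) (X := {x})).union hX
      rw [Finset.card_singleton, ← Finset.insert_eq, Nat.add_comm] at this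
      exact this
    · obtain ⟨Y, hY, h1⟩ := ih hX
      exact ⟨Y, hY.trans (Finset.subset_insert _ _), h1⟩

theorem nonempty_of_not_le (h : ¬ Le R X k) : X.Nonempty := by
  by_contra hX
  rw [Finset.not_nonempty_iff_eq_empty] at hX
  exact h (hX ▸ le_empty)

theorem Le.sdiff (h : ¬ Le R X (k + l)) (hY : Le R Y l) : ¬ Le R (X \ Y) k := fun h' =>
  h ((h'.union hY).subset (by
    intro x hx
    simp only [Finset.mem_union, Finset.mem_sdiff]
    tauto))

theorem subset_in_out (hR : IsTour R) : X ⊆ inN R v X ∪ outN R v X ∪ {v} := by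
  intro x hx
  simp only [Finset.mem_union, mem_inN, mem_outN, Finset.mem_singleton]
  by_cases h : x = v
  · exact Or.inr h
  · by_cases h' : R x v
    · exact Or.inl (Or.inl ⟨hx, h'⟩)
    · exact Or.inl (Or.inr ⟨hx, hR.of_not h h'⟩)

theorem le_of_in_out (hR : IsTour R) (h1 : Le R (inN R v X) k) (h2 : Le R (outN R v X) l) :
    Le R X (k + l + 1) :=
  ((h1.union h2).union (by simpa using le_card (R := R) (X := {v}))).subset (subset_in_out hR)

theorem not_le_out (hR : IsTour R) (h : ¬ Le R X (k + l + 1)) (h1 : Le R (inN R v X) k) :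
    ¬ Le R (outN R v X) l := fun h2 => h (le_of_in_out hR h1 h2)

theorem not_le_in (hR : IsTour R) (h : ¬ Le R X (k + l + 1)) (h1 : Le R (outN R v X) k) :
    ¬ Le R (inN R v X) l := fun h2 => h ((le_of_in_out hR h2 h1).le (by omega))

/-- If the fibres of `t` have clique number at most `c`, rank `X` first by `t` and then by good
rankings of the fibres: a large backedge clique meets many fibres. -/
theorem exists_layered_clique {c p : ℕ} (t : V → ℕ) (ht : ∀ i, Le R (X.filter (t · = i)) c)
    (h : ¬ Le R X (p * c)) :
    ∃ K ⊆ X, p < K.card ∧ Set.InjOn t K ∧ ∀ x ∈ K, ∀ y ∈ K, t x < t y → R y x := by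
  choose ρ hi hρ using ht
  obtain ⟨B, hB⟩ : ∃ B, ∀ x ∈ X, ρ (t x) x < B :=
    ⟨X.sup (fun x => ρ (t x) x) + 1, fun x hx =>
      Nat.lt_succ_of_le (Finset.le_sup (f := fun x => ρ (t x) x) hx)⟩
  have hlt : ∀ x ∈ X, ∀ y ∈ X, t x < t y → t x * B + ρ (t x) x < t y * B + ρ (t y) y := by
    intro x hx y _ hxy
    have h1 := hB x hx
    have h2 : (t x + 1) * B ≤ t y * B := Nat.mul_le_mul_right _ hxy
    rw [Nat.succ_mul] at h2
    omega
  have hex : ∃ K ⊆ X, BackClique R (fun v => t v * B + ρ (t v) v) K ∧ p * c < K.card := by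
    by_contra! hcon
    refine h ⟨fun v => t v * B + ρ (t v) v, fun x hx y hy hxy => ?_, hcon⟩
    have hxy' : t x = t y := by
      by_contra hne
      rcases Nat.lt_or_gt_of_ne hne with hl | hl
      · exact (hlt x hx y hy hl).ne hxy
      · exact (hlt y hy x hx hl).ne hxy.symm
    refine hi (t x) (by simpa using hx) (by simpa [hxy'] using hy) ?_
    simp only [← hxy'] at hxy
    omega
  obtain ⟨K, hK, hc, hcard⟩ := hex
  have hfib : ∀ i ∈ K.image t, (K.filter (t · = i)).card ≤ c := by
    intro i _
    refine hρ i _ (Finset.filter_subset_filter _ hK) fun x hx y hy hxy => ?_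
    rw [Finset.mem_filter] at hx hy
    refine hc x hx.1 y hy.1 ?_
    simp only [hx.2, hy.2]
    omega
  have himg : p < (K.image t).card := by
    have := Finset.card_le_mul_card_image K c hfib
    by_contra! hle
    have h3 : c * (K.image t).card ≤ c * p := Nat.mul_le_mul_left _ hle
    rw [Nat.mul_comm] at hcard
    omega
  have : Nonempty V := ⟨(Finset.card_pos.1 ((Nat.zero_le _).trans_lt hcard)).choose⟩
  have hsec : ∀ i ∈ K.image t, ∃ x ∈ K, t x = i := fun i hi => Finset.mem_image.1 hi
  choose! s hs hts using hsec
  have hinj : Set.InjOn s (K.image t) := fun i hi j hj hij => by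
    rw [← hts i hi, ← hts j hj, hij]
  refine ⟨(K.image t).image s, ?_, ?_, ?_, ?_⟩
  · intro x hx
    obtain ⟨i, hi, rfl⟩ := Finset.mem_image.1 hx
    exact hK (hs i hi)
  · rwa [Finset.card_image_of_injOn hinj]
  · intro x hx y hy hxy
    obtain ⟨i, hi, rfl⟩ := Finset.mem_image.1 hx
    obtain ⟨j, hj, rfl⟩ := Finset.mem_image.1 hy
    rw [hts i hi, hts j hj] at hxy
    rw [hxy]
  · intro x hx y hy hxy
    obtain ⟨i, hi, rfl⟩ := Finset.mem_image.1 hx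
    obtain ⟨j, hj, rfl⟩ := Finset.mem_image.1 hy
    exact hc _ (hs i hi) _ (hs j hj) (hlt _ (hK (hs i hi)) _ (hK (hs j hj)) hxy)

end Basic

/-! ### Mountains -/

/-- The vertices `w` of `X` for which `v → w → u`: if `u → v` is an arc, these complete it to a
cyclic triangle. -/
noncomputable def cyc (R : V → V → Prop) (u v : V) (X : Finset V) : Finset V :=
  X.filter (fun w => R v w ∧ R w u)

/-- `X` is an `r`-mountain. A `0`-mountain is a nonempty set; an `(r + 1)`-mountain has `r + 1`
vertices such that the cyclic triangles of `X` on each arc between them form an `r`-mountain. -/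
def Mtn (R : V → V → Prop) : ℕ → Finset V → Prop
  | 0, X => X.Nonempty
  | r + 1, X => ∃ W ⊆ X, W.card = r + 1 ∧ ∀ u ∈ W, ∀ v ∈ W, R u v → Mtn R r (cyc R u v X)

/-- Every `r`-mountain contains one with at most `mtnSize r` vertices. -/
def mtnSize : ℕ → ℕ
  | 0 => 1
  | r + 1 => (r + 1) + (r + 1) * (r + 1) * mtnSize r

section Mountain

variable {R : V → V → Prop} {X Y : Finset V} {u v w : V} {r : ℕ}

@[simp] theorem mem_cyc : w ∈ cyc R u v X ↔ w ∈ X ∧ R v w ∧ R w u := Finset.mem_filter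

theorem cyc_mono (h : X ⊆ Y) : cyc R u v X ⊆ cyc R u v Y := Finset.filter_subset_filter _ h

theorem cyc_subset : cyc R u v X ⊆ X := Finset.filter_subset _ _

theorem Mtn.mono (h : Mtn R r X) (hXY : X ⊆ Y) : Mtn R r Y := by
  induction r generalizing X Y with
  | zero => exact Finset.Nonempty.mono hXY h
  | succ r ih =>
    obtain ⟨W, hW, hc, h⟩ := h
    exact ⟨W, hW.trans hXY, hc, fun u hu v hv huv => ih (h u hu v hv huv) (cyc_mono hXY)⟩

theorem Mtn.nonempty (h : Mtn R r X) : X.Nonempty := by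
  cases r with
  | zero => exact h
  | succ r =>
    obtain ⟨W, hW, hc, -⟩ := h
    exact (Finset.card_pos.1 (by omega)).mono hW

/-- Mountains satisfy a Ramsey property for partitions into two parts. -/
theorem Mtn.of_union {a b : ℕ} {A B : Finset V} (h : Mtn R (a + b) X) (hX : X ⊆ A ∪ B) :
    Mtn R a A ∨ Mtn R b B := by
  induction hs : a + b generalizing a b A B X with
  | zero =>
    obtain rfl : a = 0 := by omega
    obtain rfl : b = 0 := by omega
    obtain ⟨x, hx⟩ := h
    exact (Finset.mem_union.1 (hX hx)).imp (fun h => ⟨x, h⟩) fun h => ⟨x, h⟩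
  | succ s ih =>
    rcases Nat.eq_zero_or_pos a with rfl | ha
    · rcases A.eq_empty_or_nonempty with rfl | hA
      · rw [Nat.zero_add] at h
        exact Or.inr (h.mono (by simpa using hX))
      · exact Or.inl hA
    rcases Nat.eq_zero_or_pos b with rfl | hb
    · rcases B.eq_empty_or_nonempty with rfl | hB
      · exact Or.inl (h.mono (by simpa using hX))
      · exact Or.inr hB
    obtain ⟨a, rfl⟩ := Nat.exists_eq_add_of_lt ha
    obtain ⟨b, rfl⟩ := Nat.exists_eq_add_of_lt hb
    simp only [Nat.zero_add] at *
    rw [hs] at h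
    obtain ⟨W, hW, hc, h⟩ := h
    have hcov : ∀ u v, cyc R u v X ⊆ cyc R u v A ∪ cyc R u v B := by
      intro u v w hw
      simp only [mem_cyc, Finset.mem_union] at hw ⊢
      have := Finset.mem_union.1 (hX hw.1)
      tauto
    by_contra! hcon
    have hcard : W.card ≤ (W ∩ A).card + (W ∩ B).card := by
      refine (Finset.card_le_card ?_).trans (Finset.card_union_le _ _)
      intro x hx
      have := Finset.mem_union.1 (hX (hW hx))
      simp only [Finset.mem_union, Finset.mem_inter]
      tauto
    rcases (by omega : a + 1 ≤ (W ∩ A).card ∨ b + 1 ≤ (W ∩ B).card) with hl | hl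
    · obtain ⟨W', hW', hc'⟩ := Finset.exists_subset_card_eq hl
      refine hcon.1 ⟨W', hW'.trans Finset.inter_subset_right, hc', fun u hu v hv huv => ?_⟩
      have hm := h u (Finset.mem_inter.1 (hW' hu)).1 v (Finset.mem_inter.1 (hW' hv)).1 huv
      rw [show s = a + (b + 1) by omega] at hm
      exact (ih hm (hcov u v) (by omega)).resolve_right fun h' => hcon.2 (h'.mono cyc_subset)
    · obtain ⟨W', hW', hc'⟩ := Finset.exists_subset_card_eq hl
      refine hcon.2 ⟨W', hW'.trans Finset.inter_subset_right, hc', fun u hu v hv huv => ?_⟩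
      have hm := h u (Finset.mem_inter.1 (hW' hu)).1 v (Finset.mem_inter.1 (hW' hv)).1 huv
      rw [show s = (a + 1) + b by omega] at hm
      exact (ih hm (hcov u v) (by omega)).resolve_left fun h' => hcon.1 (h'.mono cyc_subset)

/-- A mountain remains one after the deletion of all but a bounded number of vertices. -/
theorem Mtn.exists_small (h : Mtn R r X) : ∃ Y ⊆ X, Y.card ≤ mtnSize r ∧ Mtn R r Y := by
  induction r generalizing X with
  | zero =>
    obtain ⟨x, hx⟩ := h
    exact ⟨{x}, by simpa using hx, by simp [mtnSize], ⟨x, by simp⟩⟩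
  | succ r ih =>
    obtain ⟨W, hW, hc, h⟩ := h
    have h' : ∀ p : V × V, ∃ Y : Finset V, Y ⊆ cyc R p.1 p.2 X ∧ Y.card ≤ mtnSize r ∧
        (p ∈ W ×ˢ W → R p.1 p.2 → Mtn R r Y) := by
      intro p
      by_cases hp : p ∈ W ×ˢ W ∧ R p.1 p.2
      · have hp' := Finset.mem_product.1 hp.1
        obtain ⟨Y, h1, h2, h3⟩ := ih (h p.1 hp'.1 p.2 hp'.2 hp.2)
        exact ⟨Y, h1, h2, fun _ _ => h3⟩
      · exact ⟨∅, by simp, by simp, fun h1 h2 => (hp ⟨h1, h2⟩).elim⟩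
    choose Y hY hYc hYm using h'
    refine ⟨W ∪ (W ×ˢ W).biUnion Y, ?_, ?_, W, Finset.subset_union_left, hc, ?_⟩
    · refine Finset.union_subset hW (Finset.biUnion_subset.2 fun p _ => ?_)
      exact (hY p).trans cyc_subset
    · refine (Finset.card_union_le _ _).trans ?_
      have := Finset.card_biUnion_le_card_mul (W ×ˢ W) Y (mtnSize r) fun p _ => hYc p
      rw [Finset.card_product, hc] at this
      rw [hc, mtnSize]
      omega
    · intro u hu v hv huv
      have hmem : (u, v) ∈ W ×ˢ W := Finset.mem_product.2 ⟨hu, hv⟩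
      refine (hYm (u, v) hmem huv).mono fun w hw => ?_
      have := mem_cyc.1 (hY (u, v) hw)
      exact mem_cyc.2 ⟨Finset.mem_union_right _ (Finset.mem_biUnion.2 ⟨_, hmem, hw⟩), this.2⟩

/-- Extending a backedge clique by a vertex `v` all of whose arcs to the clique are back arcs. -/
theorem BackClique.insert {ρ : V → ℕ} {K : Finset V} (h : BackClique R ρ K)
    (h1 : ∀ w ∈ K, (ρ w < ρ v ∧ R v w) ∨ (ρ v < ρ w ∧ R w v)) :
    BackClique R ρ (insert v K) ∧ (insert v K).card = K.card + 1 := by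
  refine ⟨fun x hx y hy hxy => ?_, Finset.card_insert_of_notMem fun hv => ?_⟩
  · rcases Finset.mem_insert.1 hx with rfl | hx' <;> rcases Finset.mem_insert.1 hy with rfl | hy'
    · omega
    · exact ((h1 y hy').resolve_left (by omega)).2
    · exact ((h1 x hx').resolve_right (by omega)).2
    · exact h x hx' y hy' hxy
  · rcases h1 v hv with h | h <;> omega

/-- An `(r + 1)`-mountain has either only back arcs between its chosen vertices, or a forward arc
`x → y`; then each vertex of `cyc R x y X` forms a back arc with `x` or with `y`. -/
theorem Mtn.exists_backClique (hR : IsTour R) (ρ : V → ℕ) {k : ℕ}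
    (h : Mtn R (2 ^ (k + 1) - 1) X) : ∃ K ⊆ X, BackClique R ρ K ∧ K.card = k + 1 := by
  induction k generalizing X with
  | zero =>
    obtain ⟨x, hx⟩ := h.nonempty
    refine ⟨{x}, by simpa using hx, ?_, by simp⟩
    intro y hy z hz hyz
    rw [Finset.mem_singleton] at hy hz
    subst hy hz
    omega
  | succ k ih =>
    have hpow : 2 ^ (k + 1 + 1) - 1 = ((2 ^ (k + 1) - 1) + (2 ^ (k + 1) - 1)) + 1 := by
      have : 0 < 2 ^ (k + 1) := by positivity
      rw [pow_succ 2 (k + 1)]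
      omega
    rw [hpow] at h
    obtain ⟨W, hW, hc, h⟩ := h
    by_cases hback : BackClique R ρ W
    · have : k + 1 + 1 ≤ W.card := by
        have : k + 1 < 2 ^ (k + 1) := Nat.lt_two_pow_self
        omega
      obtain ⟨K, hK, hKc⟩ := Finset.exists_subset_card_eq this
      exact ⟨K, hK.trans hW, hback.subset hK, hKc⟩
    · simp only [BackClique] at hback
      push Not at hback
      obtain ⟨x, hx, y, hy, hxy, hyx⟩ := hback
      have hne : y ≠ x := fun e => by simp [e] at hxy
      -- Every vertex of `cyc x y X` is joined by a back arc to `y` or to `x`.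
      have hcov : cyc R x y X ⊆
          (cyc R x y X).filter (ρ · < ρ y) ∪ (cyc R x y X).filter (ρ x < ρ ·) := by
        intro w hw
        simp only [Finset.mem_union, Finset.mem_filter]
        by_cases hwy : ρ w < ρ y
        · exact Or.inl ⟨hw, hwy⟩
        · exact Or.inr ⟨hw, by omega⟩
      rcases (h x hx y hy (hR.of_not hne hyx)).of_union hcov with hm | hm
      · obtain ⟨K, hK, hb, hKc⟩ := ih hm
        have hw : ∀ w ∈ K, w ∈ X ∧ (R y w ∧ R w x) ∧ ρ w < ρ y := fun w hw => by
          have := hK hw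
          rw [Finset.mem_filter, mem_cyc] at this
          tauto
        obtain ⟨h1, h2⟩ := hb.insert (v := y) fun w hwK =>
          Or.inl ⟨(hw w hwK).2.2, (hw w hwK).2.1.1⟩
        exact ⟨_, Finset.insert_subset (hW hy) fun w hwK => (hw w hwK).1, h1, by omega⟩
      · obtain ⟨K, hK, hb, hKc⟩ := ih hm
        have hw : ∀ w ∈ K, w ∈ X ∧ (R y w ∧ R w x) ∧ ρ x < ρ w := fun w hw => by
          have := hK hw
          rw [Finset.mem_filter, mem_cyc] at this
          tauto
        obtain ⟨h1, h2⟩ := hb.insert (v := x) fun w hwK =>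
          Or.inr ⟨(hw w hwK).2.2, (hw w hwK).2.1.2⟩
        exact ⟨_, Finset.insert_subset (hW hx) fun w hwK => (hw w hwK).1, h1, by omega⟩

theorem Mtn.not_le (hR : IsTour R) {k : ℕ} (h : Mtn R (2 ^ (k + 1) - 1) X) : ¬ Le R X k := by
  rintro ⟨ρ, -, hρ⟩
  obtain ⟨K, hK, hb, hc⟩ := h.exists_backClique hR ρ
  have := hρ K hK hb
  omega

end Mountain

/-! ### Loose chains -/

/-- Up to sets of clique number at most `κ`, every vertex of `B` is complete to `B'` and every
vertex of `B'` is complete from `B`. -/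
def Loose (R : V → V → Prop) (κ : ℕ) (B B' : Finset V) : Prop :=
  (∀ x ∈ B, Le R (inN R x B') κ) ∧ ∀ y ∈ B', Le R (outN R y B) κ

/-- `X` contains a sequence of `ℓ` sets of clique number more than `g`, each of which is loosely
complete to all later ones. -/
def HasChain (R : V → V → Prop) (κ g ℓ : ℕ) (X : Finset V) : Prop :=
  ∃ l : List (Finset V), l.length = ℓ ∧ l.Pairwise (Loose R κ) ∧ ∀ B ∈ l, B ⊆ X ∧ ¬ Le R B g

section Chain

variable {R : V → V → Prop} {X Y B B' C C' : Finset V} {κ κ' g ℓ : ℕ}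

theorem Loose.mono (h : Loose R κ B B') (hC : C ⊆ B) (hC' : C' ⊆ B') (hκ : κ ≤ κ') :
    Loose R κ' C C' :=
  ⟨fun x hx => (h.1 x (hC hx)).mono (inN_mono hC') hκ,
    fun x hx => (h.2 x (hC' hx)).mono (outN_mono hC) hκ⟩

theorem HasChain.mono (h : HasChain R κ g ℓ X) (hXY : X ⊆ Y) : HasChain R κ g ℓ Y := by
  obtain ⟨l, h1, h2, h3⟩ := h
  exact ⟨l, h1, h2, fun B hB => ⟨(h3 B hB).1.trans hXY, (h3 B hB).2⟩⟩

/-- If from every set of large clique number a bag can be split off, loosely complete to or from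
what is left, then sets of very large clique number contain long chains. -/
theorem hasChain_of_step (Φ : ℕ → ℕ)
    (h : ∀ L, ∀ X' ⊆ X, ¬ Le R X' (Φ L) → ∃ B ⊆ X', ∃ X₁ ⊆ X', ¬ Le R B g ∧ ¬ Le R X₁ L ∧
      (Loose R κ B X₁ ∨ Loose R κ X₁ B)) (hX : ¬ Le R X (Φ^[ℓ] 0)) : HasChain R κ g ℓ X := by
  induction ℓ generalizing X with
  | zero => exact ⟨[], rfl, List.Pairwise.nil, by simp⟩
  | succ ℓ ih =>
    rw [Function.iterate_succ_apply'] at hX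
    obtain ⟨B, hB, X₁, hX₁, hBg, hX₁L, hl⟩ := h _ X subset_rfl hX
    obtain ⟨l, h1, h2, h3⟩ := ih (X := X₁) (fun L X' hX' => h L X' (hX'.trans hX₁)) hX₁L
    rcases hl with hl | hl
    · refine ⟨B :: l, by simp [h1], List.pairwise_cons.2 ⟨fun C hC => ?_, h2⟩, fun C hC => ?_⟩
      · exact hl.mono subset_rfl (h3 C hC).1 le_rfl
      · rcases List.mem_cons.1 hC with rfl | hC
        · exact ⟨hB, hBg⟩
        · exact ⟨(h3 C hC).1.trans hX₁, (h3 C hC).2⟩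
    · refine ⟨l ++ [B], by simp [h1], List.pairwise_append.2 ⟨h2, by simp, fun C hC D hD => ?_⟩,
        fun C hC => ?_⟩
      · rw [List.mem_singleton.1 hD]
        exact hl.mono (h3 C hC).1 subset_rfl le_rfl
      · rcases List.mem_append.1 hC with hC | hC
        · exact ⟨(h3 C hC).1.trans hX₁, (h3 C hC).2⟩
        · rw [List.mem_singleton.1 hC]
          exact ⟨hB, hBg⟩

end Chain

/-! ### Heavy arcs -/

/-- `Block` is a property of bounded nonempty sets such that every subset of `X₀` of clique number
more than `k` contains a block. -/
structure Blocks (R : V → V → Prop) (Block : Finset V → Prop) (X₀ : Finset V) (N k : ℕ) :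
    Prop where
  tour : IsTour R
  nonempty : ∀ S, Block S → S.Nonempty
  card_le : ∀ S, Block S → S.card ≤ N
  exists_block : ∀ X ⊆ X₀, ¬ Le R X k → ∃ S ⊆ X, Block S

/-- The arc from `u` to `v` is heavy if the cyclic triangles on it contain a block. -/
def Hv (R : V → V → Prop) (Block : Finset V → Prop) (X₀ : Finset V) (u v : V) : Prop :=
  ∃ S ⊆ cyc R u v X₀, Block S

/-- `u` and `v` are joined by a heavy arc, in one of the two directions. -/
def HAdj (R : V → V → Prop) (Block : Finset V → Prop) (X₀ : Finset V) (u v : V) : Prop :=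
  (R u v ∧ Hv R Block X₀ u v) ∨ (R v u ∧ Hv R Block X₀ v u)

/-- No `q` vertices of `X` are pairwise joined by heavy arcs. -/
def NoHC (R : V → V → Prop) (Block : Finset V → Prop) (X₀ X : Finset V) (q : ℕ) : Prop :=
  ∀ K ⊆ X, (∀ x ∈ K, ∀ y ∈ K, x ≠ y → HAdj R Block X₀ x y) → K.card < q

/-- A bound on the clique number of a set without `q` vertices pairwise joined by heavy arcs all
of whose out-neighbourhoods have clique number at most `t`. -/
def ltg (N k q t : ℕ) : ℕ :=
  (t + 1) * N + 2 ^ ((t + 1) * N + 1 + q) * (t + 1) + k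

section Heavy

variable {R : V → V → Prop} {Block : Finset V → Prop} {X₀ X Y : Finset V} {N k q t : ℕ} {u v : V}

theorem HAdj.symm (h : HAdj R Block X₀ u v) : HAdj R Block X₀ v u := Or.symm h

theorem hv_flip : Hv (flip R) Block X₀ u v ↔ Hv R Block X₀ v u := by
  have : cyc (flip R) u v X₀ = cyc R v u X₀ := by
    ext w
    simp only [mem_cyc, flip]
    tauto
  simp [Hv, this]

theorem hAdj_flip : HAdj (flip R) Block X₀ u v ↔ HAdj R Block X₀ u v := by
  simp only [HAdj, hv_flip, flip]
  tauto

theorem NoHC.flip (h : NoHC R Block X₀ X q) : NoHC (flip R) Block X₀ X q := by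
  simpa only [NoHC, hAdj_flip] using h

theorem NoHC.subset (h : NoHC R Block X₀ X q) (hY : Y ⊆ X) : NoHC R Block X₀ Y q :=
  fun K hK => h K (hK.trans hY)

theorem Blocks.flip (h : Blocks R Block X₀ N k) : Blocks (flip R) Block X₀ N k :=
  ⟨h.tour.flip, h.nonempty, h.card_le, fun X hX hk => h.exists_block X hX fun h' => hk h'.flip⟩

theorem Blocks.le_cyc (h : Blocks R Block X₀ N k) (hl : ¬ Hv R Block X₀ u v) :
    Le R (cyc R u v X₀) k := by
  by_contra hk
  exact hl (h.exists_block _ cyc_subset hk)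

/-- The heavy neighbours of a vertex contain smaller sets of pairwise heavily joined vertices. -/
theorem NoHC.filter_hAdj (hR : IsTour R) (h : NoHC R Block X₀ X (q + 1)) (hu : u ∈ X) :
    NoHC R Block X₀ (X.filter (HAdj R Block X₀ u)) q := by
  intro K hK hc
  have hne : u ∉ K := fun hu' => by
    rcases (Finset.mem_filter.1 (hK hu')).2 with h | h <;> exact hR.irrefl u h.1
  have := h (insert u K)
    (Finset.insert_subset hu (hK.trans (Finset.filter_subset _ _))) fun x hx y hy hxy => by
      rcases Finset.mem_insert.1 hx with rfl | hx' <;> rcases Finset.mem_insert.1 hy with rfl | hy'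
      · exact (hxy rfl).elim
      · exact (Finset.mem_filter.1 (hK hy')).2
      · exact (Finset.mem_filter.1 (hK hx')).2.symm
      · exact hc x hx' y hy' hxy
  rw [Finset.card_insert_of_notMem hne] at this
  omega

/-- Without large backedge cliques and large sets of pairwise heavily joined vertices, a set of
bounded size dominates by light arcs: start with the first vertex in the ranking; it dominates
all vertices but its back neighbours and its heavy neighbours. -/
theorem exists_light_dominating (hR : IsTour R) {ρ : V → ℕ} {y : ℕ}
    (hρ : ∀ K ⊆ Y, BackClique R ρ K → K.card ≤ y) (hi : Set.InjOn ρ Y)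
    (hq : NoHC R Block X₀ Y q) :
    ∃ U ⊆ Y, U.card < 2 ^ (y + q) ∧ ∀ f ∈ Y, f ∈ U ∨ ∃ u ∈ U, R u f ∧ ¬ Hv R Block X₀ u f := by
  induction hs : y + q generalizing y q Y with
  | zero =>
    have := hq ∅ (by simp) (by simp)
    omega
  | succ s ih =>
    rcases Y.eq_empty_or_nonempty with rfl | hY
    · exact ⟨∅, by simp, by simp, by simp⟩
    obtain ⟨u, hu, hmin⟩ := Y.exists_min_image ρ hY
    obtain ⟨q, rfl⟩ : ∃ q', q = q' + 1 := by
      have := hq ∅ (by simp) (by simp)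
      exact ⟨q - 1, by omega⟩
    obtain ⟨y, rfl⟩ : ∃ y', y = y' + 1 := by
      have := hρ {u} (by simpa using hu) (by
        intro a ha b hb hab
        rw [Finset.mem_singleton] at ha hb
        subst ha hb
        omega)
      rw [Finset.card_singleton] at this
      exact ⟨y - 1, by omega⟩
    obtain ⟨U₁, hU₁, hc₁, hd₁⟩ := ih (Y := inN R u Y) (y := y) (q := q + 1) (by
      intro K hK hb
      have hlt : ∀ w ∈ K, ρ u < ρ w := fun w hw => by
        have hw' := mem_inN.1 (hK hw)
        exact (hmin w hw'.1).lt_of_ne fun e => hR.ne hw'.2 (hi hw'.1 hu e.symm)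
      obtain ⟨h1, h2⟩ := hb.insert (v := u) fun w hw =>
        Or.inr ⟨hlt w hw, (mem_inN.1 (hK hw)).2⟩
      have := hρ _ (Finset.insert_subset hu (hK.trans inN_subset)) h1
      omega) (hi.mono (by exact_mod_cast inN_subset)) (hq.subset inN_subset) (by omega)
    obtain ⟨U₂, hU₂, hc₂, hd₂⟩ := ih (Y := Y.filter (HAdj R Block X₀ u)) (y := y + 1) (q := q)
      (fun K hK => hρ K (hK.trans (Finset.filter_subset _ _)))
      (hi.mono (by exact_mod_cast Finset.filter_subset _ _)) (hq.filter_hAdj hR hu) (by omega)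
    refine ⟨insert u (U₁ ∪ U₂), ?_, ?_, fun f hf => ?_⟩
    · exact Finset.insert_subset hu (Finset.union_subset (hU₁.trans inN_subset)
        (hU₂.trans (Finset.filter_subset _ _)))
    · have h1 := Finset.card_insert_le u (U₁ ∪ U₂)
      have h2 := Finset.card_union_le U₁ U₂
      rw [pow_succ]
      omega
    · have hlift : ∀ U' ⊆ insert u (U₁ ∪ U₂),
          (f ∈ U' ∨ ∃ w ∈ U', R w f ∧ ¬ Hv R Block X₀ w f) →
          f ∈ insert u (U₁ ∪ U₂) ∨ ∃ w ∈ insert u (U₁ ∪ U₂), R w f ∧ ¬ Hv R Block X₀ w f := by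
        rintro U' hU' (h | ⟨w, hw, h⟩)
        · exact Or.inl (hU' h)
        · exact Or.inr ⟨w, hU' hw, h⟩
      by_cases hfu : f = u
      · exact Or.inl (by simp [hfu])
      by_cases h1 : R f u
      · exact hlift U₁ (fun x hx => by simp [hx]) (hd₁ f (mem_inN.2 ⟨hf, h1⟩))
      by_cases h2 : HAdj R Block X₀ u f
      · exact hlift U₂ (fun x hx => by simp [hx]) (hd₂ f (Finset.mem_filter.2 ⟨hf, h2⟩))
      · have h3 : R u f := hR.of_not hfu h1
        exact Or.inr ⟨u, by simp, h3, fun h => h2 (Or.inl ⟨h3, h⟩)⟩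

theorem le_closed_out (h : Le R (outN R v X) t) : Le R (outN R v X ∪ {v}) (t + 1) :=
  h.union (by simpa using le_card (R := R) (X := {v}))

/-- Local to global: if all out-neighbourhoods have small clique number, so has the whole set.
Otherwise take `Y ⊆ X` of moderately large clique number, a bounded set `U` dominating it by light
arcs, and a block `S` in the set of vertices complete to `U`. As the out-neighbourhoods of the
vertices of `S` do not cover `Y`, some `f ∈ Y` is complete to `S`; but then `S` makes all arcs
from `U` to `f` heavy. -/
theorem Blocks.le_of_out (hB : Blocks R Block X₀ N k) (hX : X ⊆ X₀) (hq : NoHC R Block X₀ X q)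
    (ht : ∀ v ∈ X, Le R (outN R v X) t) : Le R X (ltg N k q t) := by
  by_contra hcon
  obtain ⟨Y, hY, hY1, ρ, hi, hρ⟩ := exists_subset_le (k := (t + 1) * N) (R := R) (X := X)
    fun h => hcon (h.le (by unfold ltg; omega))
  obtain ⟨U, hU, hUc, hd⟩ := exists_light_dominating hB.tour hρ hi (hq.subset hY)
  have hbad : Le R (U.biUnion fun u => outN R u X ∪ {u}) (2 ^ ((t + 1) * N + 1 + q) * (t + 1)) :=
    (le_biUnion U _ fun u hu => le_closed_out (ht u (hY (hU hu)))).le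
      (Nat.mul_le_mul_right _ hUc.le)
  obtain ⟨S, hS, hSB⟩ := hB.exists_block _ (Finset.sdiff_subset.trans hX)
    (Le.sdiff (k := k) (fun h => hcon (h.le (by unfold ltg; omega))) hbad)
  have hSX : S ⊆ X := hS.trans Finset.sdiff_subset
  have hSU : ∀ s ∈ S, ∀ u ∈ U, ¬ R u s ∧ s ≠ u := fun s hs u hu => by
    have h1 := (Finset.mem_sdiff.1 (hS hs)).2
    simp only [Finset.mem_biUnion, Finset.mem_union, mem_outN, Finset.mem_singleton] at h1
    push Not at h1
    exact ⟨fun h => (h1 u hu).1 (hSX hs) h, (h1 u hu).2⟩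
  have hcov : ¬ Y ⊆ S.biUnion fun s => outN R s X ∪ {s} := fun h => by
    refine hY1 (((le_biUnion S _ fun s hs => le_closed_out (ht s (hSX hs))).subset h).le ?_)
    rw [Nat.mul_comm]
    exact Nat.mul_le_mul_left _ (hB.card_le S hSB)
  obtain ⟨f, hf, hfS⟩ := Finset.not_subset.1 hcov
  have hfs : ∀ s ∈ S, R f s := fun s hs => by
    simp only [Finset.mem_biUnion, Finset.mem_union, mem_outN, Finset.mem_singleton] at hfS
    push Not at hfS
    exact hB.tour.of_not (hfS s hs).2.symm fun h => (hfS s hs).1 (hY hf) h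
  rcases hd f hf with hfU | ⟨u, hu, -, hl⟩
  · obtain ⟨s, hs⟩ := hB.nonempty S hSB
    exact (hSU s hs f hfU).1 (hfs s hs)
  · refine hl ⟨S, fun s hs => mem_cyc.2 ⟨hX (hSX hs), hfs s hs, ?_⟩, hSB⟩
    exact hB.tour.of_not (hSU s hs u hu).2.symm (hSU s hs u hu).1

theorem Blocks.le_of_in (hB : Blocks R Block X₀ N k) (hX : X ⊆ X₀) (hq : NoHC R Block X₀ X q)
    (ht : ∀ v ∈ X, Le R (inN R v X) t) : Le R X (ltg N k q t) :=
  le_flip.1 (hB.flip.le_of_out hX hq.flip fun v hv => (ht v hv).flip)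

theorem Blocks.exists_split (hB : Blocks R Block X₀ N k) (hX : X ⊆ X₀) (hq : NoHC R Block X₀ X q)
    (h : ¬ Le R X (ltg N k q t + ltg N k q t)) :
    ∃ x ∈ X, ¬ Le R (outN R x X) t ∧ ¬ Le R (inN R x X) t := by
  by_contra! hcon
  have h1 : Le R (X.filter fun x => Le R (outN R x X) t) (ltg N k q t) :=
    hB.le_of_out ((Finset.filter_subset _ _).trans hX) (hq.subset (Finset.filter_subset _ _))
      fun v hv => (Finset.mem_filter.1 hv).2.subset (outN_mono (Finset.filter_subset _ _))
  have h2 : Le R (X.filter fun x => Le R (inN R x X) t) (ltg N k q t) :=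
    hB.le_of_in ((Finset.filter_subset _ _).trans hX) (hq.subset (Finset.filter_subset _ _))
      fun v hv => (Finset.mem_filter.1 hv).2.subset (inN_mono (Finset.filter_subset _ _))
  refine h ((h1.union h2).subset fun x hx => ?_)
  simp only [Finset.mem_union, Finset.mem_filter]
  by_cases h' : Le R (outN R x X) t
  · exact Or.inl ⟨hx, h'⟩
  · exact Or.inr ⟨hx, hcon x hx h'⟩

/-- A bound on the clique number of a set without `q` pairwise heavily joined vertices and without
a chain of length `ℓ` of bags of clique number more than `g`. -/
def chainBound (N k g ℓ : ℕ) : ℕ → ℕ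
  | 0 => 0
  | q + 1 => (fun L => ltg N k (q + 1) (max g L + chainBound N k g ℓ q) +
      ltg N k (q + 1) (max g L + chainBound N k g ℓ q))^[ℓ] 0

/-- Split at a vertex `x`: without the heavy neighbours of `x`, its in-neighbourhood is loosely
complete to its out-neighbourhood. -/
theorem Blocks.hasChain_or_le (hB : Blocks R Block X₀ N k) (g ℓ : ℕ) (hX : X ⊆ X₀)
    (hq : NoHC R Block X₀ X q) : HasChain R k g ℓ X ∨ Le R X (chainBound N k g ℓ q) := by
  induction q generalizing X with
  | zero =>
    have := hq ∅ (by simp) (by simp)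
    omega
  | succ q ih =>
    by_contra! hcon
    refine hcon.1 (hasChain_of_step _ (fun L X' hX' h => ?_) hcon.2)
    obtain ⟨x, hx, h1, h2⟩ := hB.exists_split (hX'.trans hX) (hq.subset hX') h
    set H := X'.filter (HAdj R Block X₀ x) with hH
    have hle : Le R H (chainBound N k g ℓ q) :=
      (ih (((Finset.filter_subset _ _).trans hX').trans hX)
        ((hq.subset hX').filter_hAdj hB.tour hx)).resolve_left fun h =>
          hcon.1 (h.mono ((Finset.filter_subset _ _).trans hX'))
    have hlight : ∀ w ∈ X', w ∉ H → ¬ HAdj R Block X₀ x w := fun w hw hwH h =>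
      hwH (Finset.mem_filter.2 ⟨hw, h⟩)
    refine ⟨inN R x X' \ H, Finset.sdiff_subset.trans inN_subset, outN R x X' \ H,
      Finset.sdiff_subset.trans outN_subset, fun h => Le.sdiff h2 hle (h.le (le_max_left _ _)),
      fun h => Le.sdiff h1 hle (h.le (le_max_right _ _)), Or.inl ⟨fun z hz => ?_, fun y hy => ?_⟩⟩
    · rw [Finset.mem_sdiff, mem_inN] at hz
      have hl : ¬ Hv R Block X₀ z x := fun h => hlight z hz.1.1 hz.2 (Or.inr ⟨hz.1.2, h⟩)
      refine (hB.le_cyc hl).subset fun w hw => ?_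
      rw [mem_inN, Finset.mem_sdiff, mem_outN] at hw
      exact mem_cyc.2 ⟨hX (hX' hw.1.1.1), hw.1.1.2, hw.2⟩
    · rw [Finset.mem_sdiff, mem_outN] at hy
      have hl : ¬ Hv R Block X₀ x y := fun h => hlight y hy.1.1 hy.2 (Or.inl ⟨hy.1.2, h⟩)
      refine (hB.le_cyc hl).subset fun w hw => ?_
      rw [mem_outN, Finset.mem_sdiff, mem_inN] at hw
      exact mem_cyc.2 ⟨hX (hX' hw.1.1.1), hw.2, hw.1.1.2⟩

end Heavy

/-! ### Existence of chains -/

/-- Sets of large clique number contain long chains or high mountains. For the induction, take the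
`r`-mountains of bounded size as blocks: `r + 1` vertices pairwise joined by heavy arcs form an
`(r + 1)`-mountain. -/
theorem exists_chain_or_mtn (g : ℕ → ℕ) (ℓ r : ℕ) :
    ∃ c, ∀ (V : Type u) (R : V → V → Prop) (X : Finset V), IsTour R →
      (∃ κ, HasChain R κ (g κ) ℓ X) ∨ Le R X c ∨ Mtn R r X := by
  induction r with
  | zero =>
    refine ⟨0, fun V R X _ => Or.inr ?_⟩
    rcases X.eq_empty_or_nonempty with rfl | hX
    · exact Or.inl le_empty
    · exact Or.inr hX
  | succ r ih =>
    obtain ⟨c, hc⟩ := ih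
    refine ⟨chainBound (mtnSize r) c (g c) ℓ (r + 1), fun V R X hR => ?_⟩
    by_contra! hcon
    obtain ⟨hch, hle, hm⟩ := hcon
    have hB : Blocks R (fun S => Mtn R r S ∧ S.card ≤ mtnSize r) X (mtnSize r) c :=
      ⟨hR, fun S hS => hS.1.nonempty, fun S hS => hS.2, fun X' hX' h => by
        rcases hc V R X' hR with ⟨κ, h'⟩ | h' | h'
        · exact (hch κ (h'.mono hX')).elim
        · exact (h h').elim
        · obtain ⟨S, hS, h1, h2⟩ := h'.exists_small
          exact ⟨S, hS, h2, h1⟩⟩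
    refine (hB.hasChain_or_le (g c) ℓ subset_rfl (q := r + 1) fun K hK hKc => ?_).elim (hch c) hle
    by_contra! hcard
    obtain ⟨W, hW, hWc⟩ := Finset.exists_subset_card_eq hcard
    refine hm ⟨W, hW.trans hK, hWc, fun u hu v hv huv => ?_⟩
    rcases hKc u (hW hu) v (hW hv) (hR.ne huv) with ⟨-, S, hS, h⟩ | ⟨h, -⟩
    · exact h.1.mono hS
    · exact (hR.asymm huv h).elim

/-- Sets of large clique number contain long chains. A high mountain yields a set `S` of bounded
size but large clique number; many of the other vertices agree in their arcs to `S`, and are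
therefore complete to or complete from a large part of `S`. -/
theorem exists_chain (g : ℕ → ℕ) (ℓ : ℕ) :
    ∃ c, ∀ (V : Type u) (R : V → V → Prop) (X : Finset V), IsTour R →
      Le R X c ∨ ∃ κ, HasChain R κ (g κ) ℓ X := by
  set r := 2 ^ (g 0 + g 0 + 1) - 1 with hr
  obtain ⟨c, hc⟩ := exists_chain_or_mtn.{u} g ℓ r
  set N := mtnSize r with hN
  refine ⟨(fun L => c + (2 ^ N * L + N))^[ℓ] 0, fun V R X hR => ?_⟩
  by_contra! hcon
  refine hcon.2 0 (hasChain_of_step _ (fun L X' hX' h => ?_) hcon.1)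
  have hm : Mtn R r X' := by
    rcases hc V R X' hR with ⟨κ, h'⟩ | h' | h'
    · exact (hcon.2 κ (h'.mono hX')).elim
    · exact (h (h'.le (by omega))).elim
    · exact h'
  obtain ⟨S, hS, hSc, hSm⟩ := hm.exists_small
  have hS2 : ¬ Le R S (g 0 + g 0) := hSm.not_le hR
  have h1 : ¬ Le R (X' \ S) (2 ^ N * L) :=
    Le.sdiff (fun h' => h (h'.le (by omega))) (le_card.le hSc)
  obtain ⟨P, hP, hPL⟩ : ∃ P ∈ S.powerset,
      ¬ Le R ((X' \ S).filter fun v => S.filter (R v) = P) L := by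
    by_contra! h'
    refine h1 ((le_of_fibres S.powerset (fun v => S.filter (R v)) (fun x _ => ?_)
      fun P hP => by convert h' P hP).le ?_)
    · exact Finset.mem_powerset.2 (Finset.filter_subset _ _)
    · rw [Finset.card_powerset]
      exact Nat.mul_le_mul_right _ (Nat.pow_le_pow_right (by norm_num) hSc)
  have hPS := Finset.mem_powerset.1 hP
  have hX₁ : ∀ x ∈ (X' \ S).filter (fun v => S.filter (R v) = P), x ∉ S ∧ ∀ s ∈ S, R x s ↔ s ∈ P :=
    fun x hx => by
      rw [Finset.mem_filter, Finset.mem_sdiff] at hx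
      refine ⟨hx.1.2, fun s hs => ?_⟩
      rw [← hx.2, Finset.mem_filter]
      exact ⟨fun h => ⟨hs, h⟩, fun h => h.2⟩
  have hempty : ∀ Z : Finset V, (∀ z, z ∉ Z) → Le R Z 0 := fun Z hZ => by
    rw [Finset.eq_empty_of_forall_notMem hZ]
    exact le_empty
  rw [← Finset.union_sdiff_of_subset hPS] at hS2
  rcases Le.of_union hS2 with hbig | hbig
  · refine ⟨P, hPS.trans hS, _, (Finset.filter_subset _ _).trans Finset.sdiff_subset, hbig, hPL,
      Or.inr ⟨fun x hx => hempty _ fun s hs => ?_, fun s hs => hempty _ fun x hx => ?_⟩⟩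
    · rw [mem_inN] at hs
      exact hR.asymm hs.2 (((hX₁ x hx).2 s (hPS hs.1)).2 hs.1)
    · rw [mem_outN] at hx
      exact hR.asymm hx.2 (((hX₁ x hx.1).2 s (hPS hs)).2 hs)
  · refine ⟨S \ P, Finset.sdiff_subset.trans hS, _,
      (Finset.filter_subset _ _).trans Finset.sdiff_subset, hbig, hPL,
      Or.inl ⟨fun s hs => hempty _ fun x hx => ?_, fun x hx => hempty _ fun s hs => ?_⟩⟩
    · rw [mem_inN] at hx
      rw [Finset.mem_sdiff] at hs
      exact hs.2 (((hX₁ x hx.1).2 s hs.1).1 hx.2)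
    · rw [mem_outN, Finset.mem_sdiff] at hs
      exact hs.1.2 (((hX₁ x hx).2 s hs.1.1).1 hs.2)

/-! ### Copies of the tournaments `D n` and `A n` -/

/-- `X` contains a copy of `D n`. -/
def Dp (R : V → V → Prop) : ℕ → Finset V → Prop
  | 0, _ => True
  | n + 1, X => ∃ v ∈ X, ∃ A ⊆ X, ∃ B ⊆ X, Dp R n A ∧ Dp R n B ∧ (∀ x ∈ A, R v x) ∧
      (∀ y ∈ B, R y v) ∧ ∀ x ∈ A, ∀ y ∈ B, R x y

/-- `X` contains a copy of `A n`. Vertices and copies of `A (n - 1)` are indexed by `ℕ`; only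
the first `n` and `n - 1` of them matter. -/
def Ap (R : V → V → Prop) : ℕ → Finset V → Prop
  | 0, _ => True
  | n + 1, X => ∃ (v : ℕ → V) (T : ℕ → Finset V), (∀ i ≤ n, v i ∈ X) ∧
      (∀ i < n, T i ⊆ X ∧ Ap R n (T i)) ∧ (∀ i j, i < j → j ≤ n → R (v j) (v i)) ∧
      (∀ i j, i < j → j < n → ∀ x ∈ T i, ∀ y ∈ T j, R x y) ∧
      (∀ i j, i ≤ j → j < n → ∀ y ∈ T j, R (v i) y) ∧
      ∀ i j, j < i → i ≤ n → ∀ y ∈ T j, R y (v i)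

/-- An upper bound for the number of vertices of `D n`. -/
def dSize : ℕ → ℕ
  | 0 => 0
  | n + 1 => 1 + dSize n + dSize n

/-- An upper bound for the number of vertices of `A n`. -/
def aSize : ℕ → ℕ
  | 0 => 0
  | n + 1 => (n + 1) + n * aSize n

section Copies

variable {R : V → V → Prop} {X Y : Finset V} {n : ℕ}

theorem Dp.mono (h : Dp R n X) (hXY : X ⊆ Y) : Dp R n Y := by
  cases n with
  | zero => trivial
  | succ n =>
    obtain ⟨v, hv, A, hA, B, hB, h⟩ := h
    exact ⟨v, hXY hv, A, hA.trans hXY, B, hB.trans hXY, h⟩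

theorem Dp.exists_small (h : Dp R n X) : ∃ Y ⊆ X, Y.card ≤ dSize n ∧ Dp R n Y := by
  induction n generalizing X with
  | zero => exact ⟨∅, by simp, by simp, trivial⟩
  | succ n ih =>
    obtain ⟨v, hv, A, hA, B, hB, h1, h2, h3, h4, h5⟩ := h
    obtain ⟨A', hA', cA, dA⟩ := ih h1
    obtain ⟨B', hB', cB, dB⟩ := ih h2
    refine ⟨{v} ∪ A' ∪ B', ?_, ?_, v, by simp, A', fun x hx => by simp [hx], B',
      fun x hx => by simp [hx], dA, dB, fun x hx => h3 x (hA' hx), fun y hy => h4 y (hB' hy),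
      fun x hx y hy => h5 x (hA' hx) y (hB' hy)⟩
    · exact Finset.union_subset (Finset.union_subset (by simpa using hv) (hA'.trans hA))
        (hB'.trans hB)
    · have c1 := Finset.card_union_le ({v} ∪ A') B'
      have c2 := Finset.card_union_le {v} A'
      rw [Finset.card_singleton] at c2
      simp only [dSize]
      omega

theorem Ap.mono (h : Ap R n X) (hXY : X ⊆ Y) : Ap R n Y := by
  cases n with
  | zero => trivial
  | succ n =>
    obtain ⟨v, T, hv, hT, h⟩ := h
    exact ⟨v, T, fun i hi => hXY (hv i hi), fun i hi => ⟨(hT i hi).1.trans hXY, (hT i hi).2⟩, h⟩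

theorem Ap.exists_small (h : Ap R n X) : ∃ Y ⊆ X, Y.card ≤ aSize n ∧ Ap R n Y := by
  induction n generalizing X with
  | zero => exact ⟨∅, by simp, by simp, trivial⟩
  | succ n ih =>
    obtain ⟨v, T, hv, hT, h1, h2, h3, h4⟩ := h
    have hex : ∀ i, ∃ Y : Finset V, Y ⊆ T i ∧ Y.card ≤ aSize n ∧ (i < n → Ap R n Y) := by
      intro i
      by_cases hi : i < n
      · obtain ⟨Y, hY, hYc, hYA⟩ := ih (hT i hi).2
        exact ⟨Y, hY, hYc, fun _ => hYA⟩
      · exact ⟨∅, by simp, by simp, fun h => (hi h).elim⟩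
    choose T' hT' cT' aT' using hex
    refine ⟨(Finset.range (n + 1)).image v ∪ (Finset.range n).biUnion T', ?_, ?_, v, T',
      fun i hi => ?_, fun i hi => ⟨fun x hx => ?_, aT' i hi⟩, h1, fun i j hij hj x hx y hy =>
        h2 i j hij hj x (hT' i hx) y (hT' j hy), fun i j hij hj y hy =>
        h3 i j hij hj y (hT' j hy), fun i j hij hi y hy => h4 i j hij hi y (hT' j hy)⟩
    · refine Finset.union_subset (fun x hx => ?_) (fun x hx => ?_)
      · obtain ⟨i, hi, rfl⟩ := Finset.mem_image.1 hx
        exact hv i (by rw [Finset.mem_range] at hi; omega)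
      · obtain ⟨i, hi, hx⟩ := Finset.mem_biUnion.1 hx
        exact (hT i (Finset.mem_range.1 hi)).1 (hT' i hx)
    · refine (Finset.card_union_le _ _).trans ?_
      have c1 : ((Finset.range (n + 1)).image v).card ≤ n + 1 := by
        simpa using Finset.card_image_le (s := Finset.range (n + 1)) (f := v)
      have c2 := Finset.card_biUnion_le_card_mul (Finset.range n) T' (aSize n) fun i _ => cT' i
      rw [Finset.card_range] at c2
      simp only [aSize]
      omega
    · exact Finset.mem_union_left _ (Finset.mem_image_of_mem v (by simp; omega))
    · exact Finset.mem_union_right _ (Finset.mem_biUnion.2 ⟨i, by simpa using hi, hx⟩)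

end Copies

/-! ### Sets without a copy of `D (n + 1)` -/

/-- `X` contains no copy of `D (n + 1)`, but every subset of clique number more than `k` contains
a copy of `D n` of size at most `a`. -/
structure NoD (R : V → V → Prop) (X : Finset V) (n k a : ℕ) : Prop where
  tour : IsTour R
  not_dp : ¬ Dp R (n + 1) X
  exists_dp : ∀ Y ⊆ X, ¬ Le R Y k → ∃ Z ⊆ Y, Z.card ≤ a ∧ Dp R n Z

section NoD

variable {R : V → V → Prop} {X A B P Q S T : Finset V} {n k a κ : ℕ} {v : V}

/-- There are no large `A` and `B` with arcs from `B` to `v`, from `v` to `A` and, loosely,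
from `A` to `B`. -/
theorem NoD.false_of_in (h : NoD R X n k a) (hv : v ∈ X) (hAX : A ⊆ X) (hBX : B ⊆ X)
    (hA : ∀ x ∈ A, R v x) (hB : ∀ y ∈ B, R y v) (hl : ∀ x ∈ A, Le R (inN R x B) κ)
    (hAk : ¬ Le R A k) (hBk : ¬ Le R B (k + a * κ)) : False := by
  obtain ⟨A₀, hA₀, hc, hd⟩ := h.exists_dp A hAX hAk
  have hbad : Le R (A₀.biUnion fun x => inN R x B) (a * κ) :=
    (le_biUnion A₀ _ fun x hx => hl x (hA₀ hx)).le (Nat.mul_le_mul_right _ hc)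
  obtain ⟨B₀, hB₀, -, hd'⟩ := h.exists_dp _ (Finset.sdiff_subset.trans hBX) (Le.sdiff hBk hbad)
  have hB₀B : B₀ ⊆ B := hB₀.trans Finset.sdiff_subset
  refine h.not_dp ⟨v, hv, A₀, hA₀.trans hAX, B₀, hB₀B.trans hBX, hd, hd',
    fun x hx => hA x (hA₀ hx), fun y hy => hB y (hB₀B hy), fun x hx y hy => ?_⟩
  refine h.tour.of_not (fun e => h.tour.asymm (hA x (hA₀ hx)) (e ▸ hB y (hB₀B hy))) fun hyx => ?_
  exact (Finset.mem_sdiff.1 (hB₀ hy)).2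
    (Finset.mem_biUnion.2 ⟨x, hx, mem_inN.2 ⟨hB₀B hy, hyx⟩⟩)

theorem NoD.false_of_out (h : NoD R X n k a) (hv : v ∈ X) (hAX : A ⊆ X) (hBX : B ⊆ X)
    (hA : ∀ x ∈ A, R v x) (hB : ∀ y ∈ B, R y v) (hl : ∀ y ∈ B, Le R (outN R y A) κ)
    (hBk : ¬ Le R B k) (hAk : ¬ Le R A (k + a * κ)) : False := by
  obtain ⟨B₀, hB₀, hc, hd⟩ := h.exists_dp B hBX hBk
  have hbad : Le R (B₀.biUnion fun y => outN R y A) (a * κ) :=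
    (le_biUnion B₀ _ fun x hx => hl x (hB₀ hx)).le (Nat.mul_le_mul_right _ hc)
  obtain ⟨A₀, hA₀, -, hd'⟩ := h.exists_dp _ (Finset.sdiff_subset.trans hAX) (Le.sdiff hAk hbad)
  have hA₀A : A₀ ⊆ A := hA₀.trans Finset.sdiff_subset
  refine h.not_dp ⟨v, hv, A₀, hA₀A.trans hAX, B₀, hB₀.trans hBX, hd', hd,
    fun x hx => hA x (hA₀A hx), fun y hy => hB y (hB₀ hy), fun x hx y hy => ?_⟩
  refine h.tour.of_not (fun e => h.tour.asymm (hA x (hA₀A hx)) (e ▸ hB y (hB₀ hy))) fun hyx => ?_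
  exact (Finset.mem_sdiff.1 (hA₀ hx)).2
    (Finset.mem_biUnion.2 ⟨y, hy, mem_outN.2 ⟨hA₀A hx, hyx⟩⟩)

/-- Few in-neighbours of `v` in `T`: a large set `P` of out-neighbours of `v` loosely complete to
`T` forces this. -/
theorem NoD.le_inN (h : NoD R X n k a) (hv : v ∈ X) (hP : P ⊆ X) (hT : T ⊆ X)
    (hl : ∀ y ∈ T, Le R (outN R y P) κ) (hPk : ¬ Le R (outN R v P) (k + a * κ)) :
    Le R (inN R v T) k := by
  by_contra hk
  refine h.false_of_out hv (outN_subset.trans hP) (inN_subset.trans hT)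
    (fun x hx => (mem_outN.1 hx).2) (fun y hy => (mem_inN.1 hy).2) (fun y hy => ?_) hk hPk
  exact (hl y (inN_subset hy)).subset (outN_mono outN_subset)

/-- Few out-neighbours of `v` in `T`: a large set `P` of in-neighbours of `v` to which `T` is
loosely complete forces this. -/
theorem NoD.le_outN (h : NoD R X n k a) (hv : v ∈ X) (hP : P ⊆ X) (hT : T ⊆ X)
    (hl : ∀ x ∈ T, Le R (inN R x P) κ) (hPk : ¬ Le R (inN R v P) (k + a * κ)) :
    Le R (outN R v T) k := by
  by_contra hk
  refine h.false_of_in hv (outN_subset.trans hT) (inN_subset.trans hP)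
    (fun x hx => (mem_outN.1 hx).2) (fun y hy => (mem_inN.1 hy).2) (fun y hy => ?_) hk hPk
  exact (hl y (outN_subset hy)).subset (inN_mono inN_subset)

/-- An intermediate bag brings the looseness of two bags of a chain down to `k`. -/
theorem NoD.loose (h : NoD R X n k a) (hP : P ⊆ X) (hQ : Q ⊆ X) (hT : T ⊆ X)
    (hPQ : Loose R κ P Q) (hQT : Loose R κ Q T) (hQk : ¬ Le R Q (κ + (k + a * κ) + 1)) :
    Loose R k P T :=
  ⟨fun x hx => h.le_inN (hP hx) hQ hT hQT.2 (not_le_out h.tour hQk (hPQ.1 x hx)),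
    fun y hy => h.le_outN (hT hy) hQ hP hPQ.1 (not_le_in h.tour hQk (hQT.2 y hy))⟩

end NoD

/-! ### Longest chains -/

section Seq

variable {R : V → V → Prop} {X : Finset V} {κ g r : ℕ}

theorem hasChain_iff : HasChain R κ g r X ↔ ∃ S : ℕ → Finset V,
    (∀ i j, i < j → j < r → Loose R κ (S i) (S j)) ∧ ∀ i < r, S i ⊆ X ∧ ¬ Le R (S i) g := by
  constructor
  · rintro ⟨l, rfl, h1, h2⟩
    have hget : ∀ i (hi : i < l.length), l.getD i ∅ = l[i] := fun i hi => by simp [hi]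
    refine ⟨fun i => l.getD i ∅, fun i j hij hj => ?_, fun i hi => ?_⟩
    · simp only [hget i (hij.trans hj), hget j hj]
      exact List.pairwise_iff_getElem.1 h1 i j _ _ hij
    · simp only [hget i hi]
      exact h2 _ (List.getElem_mem hi)
  · rintro ⟨S, h1, h2⟩
    refine ⟨(List.range r).map S, by simp, ?_, fun B hB => ?_⟩
    · rw [List.pairwise_iff_getElem]
      intro i j hi hj hij
      simp only [List.length_map, List.length_range] at hi hj
      simpa using h1 i j hij hj
    · obtain ⟨i, hi, rfl⟩ := List.mem_map.1 hB
      exact h2 i (List.mem_range.1 hi)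

theorem Loose.self_le (hR : IsTour R) {B : Finset V} (h : Loose R κ B B) :
    Le R B (κ + κ + 1) := by
  rcases B.eq_empty_or_nonempty with rfl | ⟨v, hv⟩
  · exact le_empty
  · exact le_of_in_out hR (h.1 v hv) (h.2 v hv)

theorem HasChain.length_le (hR : IsTour R) (hg : κ + κ + 1 ≤ g) (h : HasChain R κ g r X) :
    r ≤ 2 ^ X.card := by
  obtain ⟨S, h1, h2⟩ := hasChain_iff.1 h
  have hinj : Set.InjOn S (Finset.range r) := by
    intro i hi j hj hij
    have hi := Finset.mem_range.1 hi
    have hj := Finset.mem_range.1 hj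
    by_contra hne
    rcases Nat.lt_or_gt_of_ne hne with hl | hl
    · have := h1 i j hl hj
      rw [← hij] at this
      exact (h2 i hi).2 ((this.self_le hR).le hg)
    · have := h1 j i hl hi
      rw [← hij] at this
      exact (h2 i hi).2 ((this.self_le hR).le hg)
  rw [← Finset.card_range r, ← Finset.card_powerset]
  refine Finset.card_le_card_of_injOn S (fun i hi => ?_) hinj
  exact Finset.mem_powerset.2 (h2 i (Finset.mem_range.1 hi)).1

theorem exists_longest_chain (hR : IsTour R) (hg : κ + κ + 1 ≤ g) :
    ∃ r, HasChain R κ g r X ∧ ¬ HasChain R κ g (r + 1) X := by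
  by_contra! hcon
  have hall : ∀ r, HasChain R κ g r X := fun r => by
    induction r with
    | zero => exact ⟨[], rfl, List.Pairwise.nil, by simp⟩
    | succ r ih => exact hcon r ih
  have := (hall (2 ^ X.card + 1)).length_le hR hg
  omega

/-- The position of `v` relative to the chain `S 0, …, S (r - 1)`: the index of the first bag in
which `v` has an out-neighbourhood of clique number more than `h`, and `r` if there is none. -/
noncomputable def chainRank (R : V → V → Prop) (h : ℕ) (S : ℕ → Finset V) (r : ℕ) (v : V) : ℕ :=
  Nat.find (p := fun i => i = r ∨ ¬ Le R (outN R v (S i)) h) ⟨r, Or.inl rfl⟩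

variable {h : ℕ} {S : ℕ → Finset V} {v : V}

theorem chainRank_le : chainRank R h S r v ≤ r := Nat.find_min' _ (Or.inl rfl)

theorem le_outN_of_lt_chainRank {i : ℕ} (hi : i < chainRank R h S r v) :
    Le R (outN R v (S i)) h := by
  have := Nat.find_min _ hi
  push Not at this
  exact this.2

theorem not_le_outN_chainRank (hlt : chainRank R h S r v < r) :
    ¬ Le R (outN R v (S (chainRank R h S r v))) h :=
  (Nat.find_spec (p := fun i => i = r ∨ ¬ Le R (outN R v (S i)) h) ⟨r, Or.inl rfl⟩).resolve_left
    hlt.ne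

end Seq

/-- A chain `S 0, …, S (r - 1)` of `k`-loose bags of clique number more than `K` in a set without
`D (n + 1)`, with `h = k + a * k` and with `K` large enough for the arguments about single vertices
and their arcs to the bags. -/
structure LongChain (R : V → V → Prop) (X : Finset V) (n k a h K r : ℕ) (S : ℕ → Finset V) :
    Prop where
  noD : NoD R X n k a
  h_eq : h = k + a * k
  le_one : h + h + 1 ≤ K
  le_two : k + (k + a * h) + 1 ≤ K
  loose : ∀ i j, i < j → j < r → Loose R k (S i) (S j)
  subset : ∀ i < r, S i ⊆ X
  not_le : ∀ i < r, ¬ Le R (S i) K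

namespace LongChain

variable {R : V → V → Prop} {X Z Z' : Finset V} {n k a h K r : ℕ} {S : ℕ → Finset V} {v : V}
  {i j : ℕ}

theorem le_inN (H : LongChain R X n k a h K r S) (hv : v ∈ X) (hj : chainRank R h S r v < j)
    (hjr : j < r) : Le R (inN R v (S j)) h := by
  have ht := hj.trans hjr
  by_contra hcon
  refine H.noD.false_of_in (κ := k) hv (outN_subset.trans (H.subset _ ht))
    (inN_subset.trans (H.subset j hjr)) (fun x hx => (mem_outN.1 hx).2)
    (fun y hy => (mem_inN.1 hy).2)
    (fun x hx => ((H.loose _ j hj hjr).1 x (outN_subset hx)).subset (inN_mono inN_subset))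
    (fun hk => not_le_outN_chainRank ht (hk.le ?_)) (by rwa [← H.h_eq])
  rw [H.h_eq]
  omega

/-- Two or more bags away from the position of `v`, the bound `h` improves to `k`. -/
theorem le_outN_of_add_lt (H : LongChain R X n k a h K r S) (hv : v ∈ X)
    (hi : i + 1 < chainRank R h S r v) : Le R (outN R v (S i)) k := by
  have hir : i + 1 < r := hi.trans_le chainRank_le
  refine H.noD.le_outN hv (H.subset _ hir) (H.subset i (by omega))
    (H.loose i _ (by omega) hir).1 ?_
  rw [← H.h_eq]
  exact not_le_in H.noD.tour (fun hk => H.not_le _ hir (hk.le H.le_one))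
    (le_outN_of_lt_chainRank hi)

theorem le_inN_of_add_lt (H : LongChain R X n k a h K r S) (hv : v ∈ X)
    (hj : chainRank R h S r v + 1 < j) (hjr : j < r) : Le R (inN R v (S j)) k := by
  have ht : chainRank R h S r v + 1 < r := hj.trans hjr
  refine H.noD.le_inN hv (H.subset _ ht) (H.subset j hjr) (H.loose _ _ hj hjr).2 ?_
  rw [← H.h_eq]
  exact not_le_out H.noD.tour (fun hk => H.not_le _ ht (hk.le H.le_one))
    (H.le_inN hv (by omega) ht)

/-- Bags well before rank `t` are loosely complete to the vertices of rank `t`. -/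
theorem loose_left (H : LongChain R X n k a h K r S) {t : ℕ} (hZ : Z ⊆ X)
    (hZt : ∀ z ∈ Z, chainRank R h S r z = t) (hi : i + 1 < t) (ht : t ≤ r) :
    Loose R k (S i) Z := by
  have hi' : ∀ z ∈ Z, i + 1 < chainRank R h S r z := fun z hz => by rwa [hZt z hz]
  refine ⟨fun x hx => ?_, fun z hz => H.le_outN_of_add_lt (hZ hz) (hi' z hz)⟩
  refine H.noD.le_inN (H.subset i (by omega) hx) (H.subset (i + 1) (by omega)) hZ
    (fun z hz => le_outN_of_lt_chainRank (hi' z hz)) ?_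
  exact not_le_out H.noD.tour (fun hk => H.not_le (i + 1) (by omega) (hk.le H.le_two))
    ((H.loose i (i + 1) (by omega) (by omega)).1 x hx)

/-- The vertices of rank `t` are loosely complete to the bags well after rank `t`. -/
theorem loose_right (H : LongChain R X n k a h K r S) {t : ℕ} (hZ : Z ⊆ X)
    (hZt : ∀ z ∈ Z, chainRank R h S r z = t) (hj : t + 1 < j) (hjr : j < r) :
    Loose R k Z (S j) := by
  refine ⟨fun z hz => H.le_inN_of_add_lt (hZ hz) (by rwa [hZt z hz]) hjr, fun y hy => ?_⟩
  refine H.noD.le_outN (H.subset j hjr hy) (H.subset (j - 1) (by omega)) hZ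
    (fun z hz => H.le_inN (hZ hz) (j := j - 1) (by rw [hZt z hz]; omega) (by omega)) ?_
  exact not_le_in H.noD.tour (fun hk => H.not_le (j - 1) (by omega) (hk.le H.le_two))
    ((H.loose (j - 1) j (by omega) hjr).2 y hy)

/-- In a longest chain, the vertices of any given rank have no long chain of their own: four bags
of such a chain could replace the at most three bags of the longest chain near that rank. -/
theorem not_hasChain (H : LongChain R X n k a h K r S)
    (hmax : ¬ HasChain R k K (r + 1) X) (t κ : ℕ) :
    ¬ HasChain R κ (K + (κ + (k + a * κ) + 1)) 7
      (X.filter fun v => chainRank R h S r v = t) := by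
  intro hch
  obtain ⟨B, hB1, hB2⟩ := hasChain_iff.1 hch
  have hBX : ∀ i < 7, B i ⊆ X := fun i hi => (hB2 i hi).1.trans (Finset.filter_subset _ _)
  have hBt : ∀ i < 7, ∀ z ∈ B i, chainRank R h S r z = t := fun i hi z hz =>
    (Finset.mem_filter.1 ((hB2 i hi).1 hz)).2
  have ht : t ≤ r := by
    obtain ⟨z, hz⟩ := nonempty_of_not_le (hB2 0 (by omega)).2
    rw [← hBt 0 (by omega) z hz]
    exact chainRank_le
  -- Every other bag of the short chain, so that the bags are `k`-loose.
  have hBk : ∀ i j, i < j → j < 4 → Loose R k (B (2 * i)) (B (2 * j)) := fun i j hij hj =>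
    H.noD.loose (hBX (2 * i) (by omega)) (hBX (2 * i + 1) (by omega)) (hBX (2 * j) (by omega))
      (hB1 _ _ (by omega) (by omega)) (hB1 _ _ (by omega) (by omega))
      fun hk => (hB2 (2 * i + 1) (by omega)).2 (hk.le (by omega))
  -- The four bags replace `S (t - 1)`, `S t` and `S (t + 1)`, as far as these exist; for `t = 0`,
  -- where the subtraction truncates, they replace `S 0` and `S 1`.
  refine hmax (hasChain_iff.2 ⟨fun i => if i < t - 1 then S i else
    if i < t - 1 + 4 then B (2 * (i - (t - 1))) else S (i - (t - 1 + 4) + (t + 2)), ?_, ?_⟩)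
  · intro i j hij hj
    by_cases hj1 : j < t - 1
    · simp only [hj1, hij.trans hj1, if_true]
      exact H.loose i j hij (by omega)
    by_cases hj2 : j < t - 1 + 4
    · by_cases hi1 : i < t - 1
      · simp only [hj1, hj2, hi1, if_true, if_false]
        exact H.loose_left (hBX _ (by omega)) (hBt _ (by omega)) (by omega) ht
      · simp only [hj1, hj2, hi1, hij.trans hj2, if_true, if_false]
        exact hBk _ _ (by omega) (by omega)
    · by_cases hi1 : i < t - 1
      · simp only [hj1, hj2, hi1, if_true, if_false]
        exact H.loose _ _ (by omega) (by omega)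
      by_cases hi2 : i < t - 1 + 4
      · simp only [hj1, hj2, hi1, hi2, if_true, if_false]
        exact H.loose_right (hBX _ (by omega)) (hBt _ (by omega)) (by omega) (by omega)
      · simp only [hj1, hj2, hi1, hi2, if_false]
        exact H.loose _ _ (by omega) (by omega)
  · intro i hi
    by_cases hi1 : i < t - 1
    · simp only [hi1, if_true]
      exact ⟨H.subset _ (by omega), H.not_le _ (by omega)⟩
    by_cases hi2 : i < t - 1 + 4
    · simp only [hi1, hi2, if_true, if_false]
      exact ⟨hBX _ (by omega), fun hk => (hB2 _ (by omega)).2 (hk.le (by omega))⟩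
    · simp only [hi1, hi2, if_false]
      exact ⟨H.subset _ (by omega), H.not_le _ (by omega)⟩

end LongChain

/-! ### Copies of `A (m + 1)` along a chain -/

section Select

variable {R : V → V → Prop}

/-- From loosely complete bags one can select bounded sets with a given property that are
complete to each other. -/
theorem exists_complete_selection (hR : IsTour R) (Q : Finset V → Prop) {k a m : ℕ}
    (S : ℕ → Finset V)
    (hQ : ∀ i < m, ∀ Y ⊆ S i, ¬ Le R Y k → ∃ Z ⊆ Y, Z.card ≤ a ∧ Q Z)
    (hS : ∀ i < m, ¬ Le R (S i) (k + m * (a * (k + 1))))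
    (hl : ∀ i j, i < j → j < m → ∀ x ∈ S i, Le R (inN R x (S j)) k) :
    ∃ T : ℕ → Finset V, (∀ i < m, T i ⊆ S i ∧ Q (T i)) ∧
      ∀ i j, i < j → j < m → ∀ x ∈ T i, ∀ y ∈ T j, R x y := by
  suffices h : ∀ p ≤ m, ∃ T : ℕ → Finset V, (∀ i < p, T i ⊆ S i ∧ (T i).card ≤ a ∧ Q (T i)) ∧
      ∀ i j, i < j → j < p → ∀ x ∈ T i, ∀ y ∈ T j, R x y by
    obtain ⟨T, h1, h2⟩ := h m le_rfl
    exact ⟨T, fun i hi => ⟨(h1 i hi).1, (h1 i hi).2.2⟩, h2⟩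
  intro p
  induction p with
  | zero => exact fun _ => ⟨fun _ => ∅, by simp, by simp⟩
  | succ p ih =>
    intro hp
    obtain ⟨T, h1, h2⟩ := ih (by omega)
    have hbad : Le R ((Finset.range p).biUnion fun i =>
        (T i).biUnion fun x => inN R x (S p) ∪ {x}) (m * (a * (k + 1))) := by
      refine (le_biUnion (k := a * (k + 1)) _ _ fun i hi => ?_).le ?_
      · have hi := Finset.mem_range.1 hi
        refine (le_biUnion (k := k + 1) _ _ fun x hx => ?_).le
          (Nat.mul_le_mul_right _ (h1 i hi).2.1)
        exact (hl i p hi (by omega) x ((h1 i hi).1 hx)).union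
          (by simpa using le_card (R := R) (X := {x}))
      · rw [Finset.card_range]
        exact Nat.mul_le_mul_right _ (by omega)
    obtain ⟨Z, hZ, hZc, hZQ⟩ := hQ p (by omega) _ Finset.sdiff_subset
      (Le.sdiff (hS p (by omega)) hbad)
    refine ⟨fun i => if i = p then Z else T i, fun i hi => ?_, fun i j hij hj x hx y hy => ?_⟩
    · by_cases hip : i = p
      · subst hip
        simp only [if_true]
        exact ⟨hZ.trans Finset.sdiff_subset, hZc, hZQ⟩
      · simp only [hip, if_false]
        exact h1 i (by omega)
    · have hip : i ≠ p := by omega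
      simp only [hip, if_false] at hx
      by_cases hjp : j = p
      · simp only [hjp, if_true] at hy
        have hy' := Finset.mem_sdiff.1 (hZ hy)
        simp only [Finset.mem_biUnion, Finset.mem_range, Finset.mem_union, mem_inN,
          Finset.mem_singleton] at hy'
        push Not at hy'
        have := hy'.2 i (by omega) x hx
        exact hR.of_not this.2 (this.1 hy'.1)
      · simp only [hjp, if_false] at hy
        exact h2 i j hij (by omega) x hx y hy

/-- A set of `2 * m + 2` vertices with distinct ranks contains `m + 1` vertices whose ranks
pairwise differ by at least two. -/
theorem exists_spaced {K : Finset V} {t : V → ℕ} {m : ℕ} (hK : 2 * m + 1 < K.card)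
    (ht : Set.InjOn t K) :
    ∃ v : ℕ → V, (∀ i ≤ m, v i ∈ K) ∧ ∀ i j, i < j → j ≤ m → t (v i) + 2 ≤ t (v j) := by
  have hcard : (K.image t).card = K.card := Finset.card_image_of_injOn ht
  let e := (K.image t).orderEmbOfFin hcard
  have hmem : ∀ i : Fin K.card, ∃ x ∈ K, t x = e i := fun i =>
    Finset.mem_image.1 (Finset.orderEmbOfFin_mem _ _ i)
  choose w hw hwt using hmem
  refine ⟨fun i => if hi : 2 * i < K.card then w ⟨2 * i, hi⟩ else w ⟨0, by omega⟩,
    fun i hi => ?_, fun i j hij hj => ?_⟩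
  · dsimp only
    split_ifs <;> exact hw _
  · have hi1 : 2 * i < K.card := by omega
    have hi2 : 2 * i + 1 < K.card := by omega
    have hj1 : 2 * j < K.card := by omega
    simp only [hi1, hj1, dif_pos, hwt]
    have e1 : e ⟨2 * i, hi1⟩ < e ⟨2 * i + 1, hi2⟩ := e.strictMono (by simp [Fin.lt_def])
    have e2 : e ⟨2 * i + 1, hi2⟩ < e ⟨2 * j, hj1⟩ := e.strictMono (by simp [Fin.lt_def]; omega)
    omega

variable {X : Finset V} {n m k a h K r : ℕ} {S : ℕ → Finset V}

/-- Vertices of well-separated ranks that pairwise form back arcs, together with copies of `A m`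
in the bags between them, form a copy of `A (m + 1)`. -/
theorem LongChain.ap_succ (H : LongChain R X n k a h K r S)
    (hA : ∀ Y ⊆ X, ¬ Le R Y k → ∃ Z ⊆ Y, Z.card ≤ a ∧ Ap R m Z)
    (hK : k + m * (a * (k + 1)) + (m + 1) * (h + 1) ≤ K) (v : ℕ → V) (hv : ∀ i ≤ m, v i ∈ X)
    (ht : ∀ i j, i < j → j ≤ m → chainRank R h S r (v i) + 2 ≤ chainRank R h S r (v j))
    (hback : ∀ i j, i < j → j ≤ m → R (v j) (v i)) : Ap R (m + 1) X := by
  set s : ℕ → ℕ := fun i => chainRank R h S r (v i) + 1 with hs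
  have hsr : ∀ i < m, s i < r := fun i hi => by
    have h1 := ht i (i + 1) (by omega) (by omega)
    have h2 : chainRank R h S r (v (i + 1)) ≤ r := chainRank_le
    simp only [hs]
    omega
  have hsm : ∀ i j, i < j → j < m → s i < s j := fun i j hij hj => by
    have := ht i j hij (by omega)
    simp only [hs]
    omega
  -- The vertices of `S (s j)` on the wrong side of `v i`.
  let bad : ℕ → ℕ → Finset V := fun i j =>
    (if i ≤ j then inN R (v i) (S (s j)) else outN R (v i) (S (s j))) ∪ {v i}
  have hbad : ∀ i ≤ m, ∀ j < m, Le R (bad i j) (h + 1) := fun i hi j hj => by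
    refine Le.union ?_ (by simpa using le_card (R := R) (X := {v i}))
    split_ifs with hij
    · refine H.le_inN (hv i hi) ?_ (hsr j hj)
      rcases hij.eq_or_lt with rfl | hlt
      · simp [hs]
      · have := ht i j hlt (by omega)
        simp only [hs]
        omega
    · refine le_outN_of_lt_chainRank ?_ (r := r)
      have := ht j i (by omega) hi
      simp only [hs]
      omega
  let S' : ℕ → Finset V := fun j => S (s j) \ (Finset.range (m + 1)).biUnion fun i => bad i j
  have hS'S : ∀ j, S' j ⊆ S (s j) := fun j => Finset.sdiff_subset
  obtain ⟨T, hT1, hT2⟩ := exists_complete_selection H.noD.tour (Ap R m) (k := k) (a := a) (m := m)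
    S' (fun i hi Y hY => hA Y ((hY.trans (hS'S i)).trans (H.subset _ (hsr i hi))))
    (fun j hj => Le.sdiff (l := (m + 1) * (h + 1)) (fun hk => H.not_le _ (hsr j hj) (hk.le hK))
      (by simpa using le_biUnion (Finset.range (m + 1)) (fun i => bad i j) fun i hi =>
        hbad i (by rw [Finset.mem_range] at hi; omega) j hj))
    fun i j hij hj x hx => ((H.loose _ _ (hsm i j hij hj) (hsr j hj)).1 x (hS'S i hx)).subset
      (inN_mono (hS'S j))
  have hTb : ∀ i ≤ m, ∀ j < m, ∀ y ∈ T j, y ∈ S (s j) ∧ y ∉ bad i j := fun i hi j hj y hy => by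
    have h1 := Finset.mem_sdiff.1 ((hT1 j hj).1 hy)
    exact ⟨h1.1, fun h2 => h1.2 (Finset.mem_biUnion.2 ⟨i, by simp; omega, h2⟩)⟩
  refine ⟨v, T, hv, fun i hi => ⟨((hT1 i hi).1.trans (hS'S i)).trans (H.subset _ (hsr i hi)),
    (hT1 i hi).2⟩, hback, hT2, fun i j hij hj y hy => ?_, fun i j hji hi y hy => ?_⟩
  · obtain ⟨h1, h2⟩ := hTb i (by omega) j hj y hy
    simp only [bad, hij, if_true, Finset.mem_union, mem_inN, Finset.mem_singleton] at h2
    push Not at h2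
    exact H.noD.tour.of_not h2.2 (h2.1 h1)
  · obtain ⟨h1, h2⟩ := hTb i hi j (by omega) y hy
    simp only [bad, hji.not_ge, if_false, Finset.mem_union, mem_outN, Finset.mem_singleton] at h2
    push Not at h2
    exact H.noD.tour.of_not (Ne.symm h2.2) (h2.1 h1)

end Select

/-! ### The upper bound -/

/-- The induction step of the upper bound: rank the vertices by their position relative to a
longest chain. All fibres have bounded clique number, so there is a large backedge clique that
meets each fibre at most once, and it extends to a copy of `A (m + 1)`. -/
theorem exists_bound_step (n m k : ℕ) :
    ∃ C, ∀ (V : Type u) (R : V → V → Prop) (X : Finset V), IsTour R → ¬ Dp R (n + 1) X →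
      ¬ Ap R (m + 1) X → (∀ Y ⊆ X, ¬ Le R Y k → Dp R n Y) → (∀ Y ⊆ X, ¬ Le R Y k → Ap R m Y) →
      Le R X C := by
  obtain ⟨a, ha⟩ : ∃ a, a = dSize n + aSize m := ⟨_, rfl⟩
  obtain ⟨h, hh⟩ : ∃ h, h = k + a * k := ⟨_, rfl⟩
  -- The three summands serve `LongChain.le_one`, `LongChain.le_two` and `LongChain.ap_succ`.
  obtain ⟨K, hK⟩ : ∃ K, K = (h + h + 1) + (k + (k + a * h) + 1) +
    (k + m * (a * (k + 1)) + (m + 1) * (h + 1)) := ⟨_, rfl⟩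
  obtain ⟨c, hc⟩ := exists_chain.{u} (fun κ => K + (κ + (k + a * κ) + 1)) 7
  refine ⟨(2 * m + 1) * c, fun V R X hR hD hA hn hm => ?_⟩
  have hN : NoD R X n k a := ⟨hR, hD, fun Y hY hYk => by
    obtain ⟨Z, hZ, hZc, hZD⟩ := (hn Y hY hYk).exists_small
    exact ⟨Z, hZ, by omega, hZD⟩⟩
  obtain ⟨r, hr, hmax⟩ := exists_longest_chain (X := X) hR (κ := k) (g := K)
    (by rw [hK, hh]; omega)
  obtain ⟨S, hS1, hS2⟩ := hasChain_iff.1 hr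
  have H : LongChain R X n k a h K r S := ⟨hN, hh, by omega, by omega, hS1,
    fun i hi => (hS2 i hi).1, fun i hi => (hS2 i hi).2⟩
  by_contra hX
  obtain ⟨L, hL, hLc, hLi, hLb⟩ := exists_layered_clique (chainRank R h S r) (fun t =>
    (hc V R _ hR).resolve_right fun ⟨κ, hκ⟩ => H.not_hasChain hmax t κ hκ) hX
  obtain ⟨v, hv, hvt⟩ := exists_spaced hLc hLi
  refine hA (H.ap_succ (fun Y hY hYk => ?_) (by omega) v (fun i hi => hL (hv i hi)) hvt
    fun i j hij hj => ?_)
  · obtain ⟨Z, hZ, hZc, hZA⟩ := (hm Y hY hYk).exists_small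
    exact ⟨Z, hZ, by omega, hZA⟩
  · have := hvt i j hij hj
    exact hLb _ (hv i (by omega)) _ (hv j hj) (by omega)

/-- Sets without a copy of `D n` and without a copy of `A m` have bounded clique number. -/
theorem exists_bound (n m : ℕ) :
    ∃ C, ∀ (V : Type u) (R : V → V → Prop) (X : Finset V), IsTour R → ¬ Dp R n X →
      ¬ Ap R m X → Le R X C := by
  induction n generalizing m with
  | zero => exact ⟨0, fun V R X _ h => (h trivial).elim⟩
  | succ n ihn =>
    induction m with
    | zero => exact ⟨0, fun V R X _ _ h => (h trivial).elim⟩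
    | succ m ihm =>
      obtain ⟨C₁, h₁⟩ := ihn (m + 1)
      obtain ⟨C₂, h₂⟩ := ihm
      obtain ⟨C, hC⟩ := exists_bound_step.{u} n m (C₁ + C₂)
      refine ⟨C, fun V R X hR hD hA => hC V R X hR hD hA (fun Y hY hk => ?_) fun Y hY hk => ?_⟩
      · by_contra hDY
        exact hk ((h₁ V R Y hR hDY fun hAY => hA (hAY.mono hY)).le (by omega))
      · by_contra hAY
        exact hk ((h₂ V R Y hR (fun hDY => hD (hDY.mono hY)) hAY).le (by omega))

/-! ### Lower bounds for `A n` and `D n` -/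

section Lower

variable {R : V → V → Prop} {X Y : Finset V} {n k : ℕ}

/-- In a copy of `A (n + 1)`, the copy `T i` of `A n` completes the arc from `v j` to `v i`, where
`i < j`, to cyclic triangles. -/
theorem Ap.mtn (hR : IsTour R) (h : Ap R (n + 1) X) : Mtn R (n + 1) X := by
  induction n generalizing X with
  | zero =>
    obtain ⟨v, T, hv, -⟩ := h
    refine ⟨{v 0}, by simpa using hv 0 le_rfl, by simp, fun u hu w hw huw => ?_⟩
    rw [Finset.mem_singleton] at hu hw
    subst hu hw
    exact (hR.irrefl _ huw).elim
  | succ n ih =>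
    obtain ⟨v, T, hv, hT, h1, -, h3, h4⟩ := h
    have hinj : Set.InjOn v (Finset.range (n + 1 + 1)) := by
      intro i hi j hj hij
      have hi := Finset.mem_range.1 hi
      have hj := Finset.mem_range.1 hj
      by_contra hne
      rcases Nat.lt_or_gt_of_ne hne with hl | hl
      · exact hR.ne (h1 i j hl (by omega)) hij.symm
      · exact hR.ne (h1 j i hl (by omega)) hij
    refine ⟨(Finset.range (n + 1 + 1)).image v, fun x hx => ?_, ?_, fun u hu w hw huw => ?_⟩
    · obtain ⟨i, hi, rfl⟩ := Finset.mem_image.1 hx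
      exact hv i (by rw [Finset.mem_range] at hi; omega)
    · rw [Finset.card_image_of_injOn hinj, Finset.card_range]
    · obtain ⟨j, hj, rfl⟩ := Finset.mem_image.1 hu
      obtain ⟨i, hi, rfl⟩ := Finset.mem_image.1 hw
      rw [Finset.mem_range] at hi hj
      have hij : i < j := by
        rcases lt_trichotomy i j with h | rfl | h
        · exact h
        · exact (hR.irrefl _ huw).elim
        · exact (hR.asymm huw (h1 j i h (by omega))).elim
      refine (ih (hT i (by omega)).2).mono fun y hy => mem_cyc.2 ⟨(hT i (by omega)).1 hy, ?_, ?_⟩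
      · exact h3 i i le_rfl (by omega) y hy
      · exact h4 j i hij (by omega) y hy

theorem Ap.not_le (hR : IsTour R) (h : Ap R (2 ^ (k + 1) - 1) X) : ¬ Le R X k := by
  obtain ⟨p, hp⟩ : ∃ p, 2 ^ (k + 1) - 1 = p + 1 := by
    have : k + 1 < 2 ^ (k + 1) := Nat.lt_two_pow_self
    exact ⟨2 ^ (k + 1) - 2, by omega⟩
  rw [hp] at h
  refine Mtn.not_le hR ?_
  rw [hp]
  exact h.mtn hR

/-- Copies of `D n` satisfy a Ramsey property for partitions into two parts. -/
theorem Dp.of_union {a b : ℕ} {A B : Finset V} (h : Dp R (a + b) X) (hX : X ⊆ A ∪ B) :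
    Dp R a A ∨ Dp R b B := by
  induction hs : a + b generalizing a b A B X with
  | zero =>
    obtain rfl : a = 0 := by omega
    exact Or.inl trivial
  | succ s ih =>
    rcases a with - | a
    · exact Or.inl trivial
    rcases b with - | b
    · exact Or.inr trivial
    rw [hs] at h
    obtain ⟨v, hv, P, hP, Q, hQ, hPd, hQd, h1, h2, h3⟩ := h
    have hcov : ∀ Z ⊆ X, Z ⊆ (Z ∩ A) ∪ (Z ∩ B) := fun Z hZ z hz => by
      have := Finset.mem_union.1 (hX (hZ hz))
      simp only [Finset.mem_union, Finset.mem_inter]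
      tauto
    by_contra! hcon
    rcases Finset.mem_union.1 (hX hv) with hvA | hvB
    · have key : ∀ Z ⊆ X, Dp R s Z → Dp R a (Z ∩ A) := fun Z hZ hZd => by
        rw [show s = a + (b + 1) by omega] at hZd
        exact (ih hZd (hcov Z hZ) (by omega)).resolve_right fun h =>
          hcon.2 (h.mono Finset.inter_subset_right)
      exact hcon.1 ⟨v, hvA, P ∩ A, Finset.inter_subset_right, Q ∩ A, Finset.inter_subset_right,
        key P hP hPd, key Q hQ hQd, fun x hx => h1 x (Finset.mem_inter.1 hx).1,
        fun x hx => h2 x (Finset.mem_inter.1 hx).1, fun x hx y hy =>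
          h3 x (Finset.mem_inter.1 hx).1 y (Finset.mem_inter.1 hy).1⟩
    · have key : ∀ Z ⊆ X, Dp R s Z → Dp R b (Z ∩ B) := fun Z hZ hZd => by
        rw [show s = (a + 1) + b by omega] at hZd
        exact (ih hZd (hcov Z hZ) (by omega)).resolve_left fun h =>
          hcon.1 (h.mono Finset.inter_subset_right)
      exact hcon.2 ⟨v, hvB, P ∩ B, Finset.inter_subset_right, Q ∩ B, Finset.inter_subset_right,
        key P hP hPd, key Q hQ hQd, fun x hx => h1 x (Finset.mem_inter.1 hx).1,
        fun x hx => h2 x (Finset.mem_inter.1 hx).1, fun x hx y hy =>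
          h3 x (Finset.mem_inter.1 hx).1 y (Finset.mem_inter.1 hy).1⟩

/-- Each of the two copies of `D (n - 1)` in a copy of `D n` has a large part on one side of the
vertex `v` in the ranking. If these parts do not form back arcs with `v`, they form back arcs with
each other. -/
theorem Dp.exists_backClique {ρ : V → ℕ} (hi : Set.InjOn ρ X)
    (h : Dp R (2 ^ (k + 1) - 1) X) (hR : IsTour R) :
    ∃ K ⊆ X, BackClique R ρ K ∧ K.card = k + 1 := by
  induction k generalizing X with
  | zero =>
    obtain ⟨v, hv, -⟩ := h
    refine ⟨{v}, by simpa using hv, ?_, by simp⟩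
    intro y hy z hz hyz
    rw [Finset.mem_singleton] at hy hz
    subst hy hz
    omega
  | succ k ih =>
    have hpos : 0 < 2 ^ (k + 1) - 1 := by
      have : k + 1 < 2 ^ (k + 1) := Nat.lt_two_pow_self
      omega
    have hpow : 2 ^ (k + 1 + 1) - 1 = ((2 ^ (k + 1) - 1) + (2 ^ (k + 1) - 1)) + 1 := by
      rw [pow_succ 2 (k + 1)]
      omega
    rw [hpow] at h
    obtain ⟨v, hv, P, hP, Q, hQ, hPd, hQd, h1, h2, h3⟩ := h
    have hcov : ∀ Z ⊆ X, v ∉ Z → Z ⊆ Z.filter (ρ · < ρ v) ∪ Z.filter (ρ v < ρ ·) :=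
      fun Z hZ hvZ z hz => by
        have : ρ z ≠ ρ v := fun e => hvZ (hi (hZ hz) hv e ▸ hz)
        simp only [Finset.mem_union, Finset.mem_filter]
        rcases Nat.lt_or_gt_of_ne this with h | h
        · exact Or.inl ⟨hz, h⟩
        · exact Or.inr ⟨hz, h⟩
    have hsub : ∀ (Z : Finset V) (p : V → Prop) [DecidablePred p], Z ⊆ X → Z.filter p ⊆ X :=
      fun Z p _ hZ => (Finset.filter_subset _ _).trans hZ
    rcases hPd.of_union (hcov P hP fun h => hR.irrefl v (h1 v h)) with hm | hPm
    · obtain ⟨K, hK, hb, hc⟩ := ih (hi.mono (by exact_mod_cast hsub P _ hP)) hm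
      obtain ⟨e1, e2⟩ := hb.insert (v := v) fun w hw =>
        have hw' := Finset.mem_filter.1 (hK hw)
        Or.inl ⟨hw'.2, h1 w hw'.1⟩
      exact ⟨_, Finset.insert_subset hv (hK.trans (hsub P _ hP)), e1, by omega⟩
    rcases hQd.of_union (hcov Q hQ fun h => hR.irrefl v (h2 v h)) with hQm | hm
    · obtain ⟨K, hK, hb, hc⟩ := ih (hi.mono (by exact_mod_cast hsub P _ hP)) hPm
      obtain ⟨q, hq⟩ := Nat.exists_eq_add_of_lt hpos
      rw [hq] at hQm
      obtain ⟨w, hw, -⟩ := hQm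
      have hw' := Finset.mem_filter.1 hw
      obtain ⟨e1, e2⟩ := hb.insert (v := w) fun x hx =>
        have hx' := Finset.mem_filter.1 (hK hx)
        Or.inr ⟨hw'.2.trans hx'.2, h3 x hx'.1 w hw'.1⟩
      exact ⟨_, Finset.insert_subset (hQ hw'.1) (hK.trans (hsub P _ hP)), e1, by omega⟩
    · obtain ⟨K, hK, hb, hc⟩ := ih (hi.mono (by exact_mod_cast hsub Q _ hQ)) hm
      obtain ⟨e1, e2⟩ := hb.insert (v := v) fun w hw =>
        have hw' := Finset.mem_filter.1 (hK hw)
        Or.inr ⟨hw'.2, h2 w hw'.1⟩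
      exact ⟨_, Finset.insert_subset hv (hK.trans (hsub Q _ hQ)), e1, by omega⟩

theorem Dp.not_le (hR : IsTour R) (h : Dp R (2 ^ (k + 1) - 1) X) : ¬ Le R X k := by
  rintro ⟨ρ, hi, hρ⟩
  obtain ⟨K, hK, hb, hc⟩ := h.exists_backClique hi hR
  have := hρ K hK hb
  omega

end Lower

/-! ### Subtournaments and the clique number -/

/-- `X` contains a copy of the tournament `S`. -/
def Copy (R : V → V → Prop) (S : Tournament.{v}) (X : Finset V) : Prop :=
  ∃ f : S.Vert → V, (∀ x, f x ∈ X) ∧ ∀ x y, R (f x) (f y) ↔ S.graph.Adj x y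

section Copy

variable {R : V → V → Prop} {X : Finset V} {n : ℕ}

theorem Dp.copy (hR : IsTour R) (h : Dp R n X) : Copy R (Tournament.D n) X := by
  induction n generalizing X with
  | zero => exact ⟨fun x => (x : Empty).elim, fun x => (x : Empty).elim, fun x => (x : Empty).elim⟩
  | succ n ih =>
    obtain ⟨v, hv, A, hA, B, hB, hAd, hBd, h1, h2, h3⟩ := h
    obtain ⟨f, hf, hfR⟩ := ih hAd
    obtain ⟨g, hg, hgR⟩ := ih hBd
    refine ⟨Sum.elim f (Sum.elim g fun _ => v), ?_, ?_⟩
    · rintro (x | x | x)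
      · exact hA (hf x)
      · exact hB (hg x)
      · exact hv
    · rintro (x | x | x) (y | y | y)
      · exact hfR x y
      · exact iff_of_true (h3 _ (hf x) _ (hg y)) trivial
      · exact iff_of_false (hR.asymm (h1 _ (hf x))) id
      · exact iff_of_false (hR.asymm (h3 _ (hf y) _ (hg x))) id
      · exact hgR x y
      · exact iff_of_true (h2 _ (hg x)) trivial
      · exact iff_of_true (h1 _ (hf y)) trivial
      · exact iff_of_false (hR.asymm (h2 _ (hg y))) id
      · exact iff_of_false (hR.irrefl v) id

theorem Copy.dp (h : Copy R (Tournament.D n) X) : Dp R n X := by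
  induction n generalizing X with
  | zero => trivial
  | succ n ih =>
    obtain ⟨f, hf, hfR⟩ := h
    let i₁ : (Tournament.D n).Vert → (Tournament.D (n + 1)).Vert := Sum.inl
    let i₂ : (Tournament.D n).Vert → (Tournament.D (n + 1)).Vert := fun x => Sum.inr (Sum.inl x)
    let v : (Tournament.D (n + 1)).Vert := Sum.inr (Sum.inr ())
    refine ⟨f v, hf v, X.filter fun y => ∃ x, f (i₁ x) = y, Finset.filter_subset _ _,
      X.filter fun y => ∃ x, f (i₂ x) = y, Finset.filter_subset _ _,
      ih ⟨f ∘ i₁, fun x => Finset.mem_filter.2 ⟨hf _, x, rfl⟩, fun x y => hfR _ _⟩,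
      ih ⟨f ∘ i₂, fun x => Finset.mem_filter.2 ⟨hf _, x, rfl⟩, fun x y => hfR _ _⟩, ?_, ?_, ?_⟩
    · intro x hx
      obtain ⟨-, x, rfl⟩ := Finset.mem_filter.1 hx
      exact (hfR _ _).2 trivial
    · intro x hx
      obtain ⟨-, x, rfl⟩ := Finset.mem_filter.1 hx
      exact (hfR _ _).2 trivial
    · intro x hx y hy
      obtain ⟨-, x, rfl⟩ := Finset.mem_filter.1 hx
      obtain ⟨-, y, rfl⟩ := Finset.mem_filter.1 hy
      exact (hfR _ _).2 trivial

theorem Ap.copy (hR : IsTour R) (h : Ap R n X) : Copy R (Tournament.A n) X := by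
  induction n generalizing X with
  | zero => exact ⟨fun x => (x : Empty).elim, fun x => (x : Empty).elim, fun x => (x : Empty).elim⟩
  | succ n ih =>
    obtain ⟨v, T, hv, hT, h1, h2, h3, h4⟩ := h
    choose f hf hfR using fun i : Fin n => ih (hT i i.2).2
    refine ⟨Sum.elim (fun p => f p.1 p.2) fun i => v i, ?_, ?_⟩
    · rintro (⟨i, x⟩ | i)
      · exact (hT i i.2).1 (hf i x)
      · exact hv i (by omega)
    · rintro (⟨i, x⟩ | i) (⟨j, y⟩ | j)
      · change R (f i x) (f j y) ↔ (i < j ∨ (i = j ∧ (Tournament.A n).graph.Adj x y))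
        rcases lt_trichotomy i j with hij | rfl | hij
        · exact iff_of_true (h2 i j hij j.2 _ (hf i x) _ (hf j y)) (Or.inl hij)
        · simpa using hfR i x y
        · refine iff_of_false (hR.asymm (h2 j i hij i.2 _ (hf j y) _ (hf i x))) ?_
          rintro (h | h)
          · exact hij.not_gt h
          · exact hij.ne' h.1
      · change R (f i x) (v j) ↔ (i : ℕ) < (j : ℕ)
        by_cases hij : (i : ℕ) < (j : ℕ)
        · exact iff_of_true (h4 j i hij (by omega) _ (hf i x)) hij
        · exact iff_of_false (hR.asymm (h3 j i (by omega) i.2 _ (hf i x))) hij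
      · change R (v i) (f j y) ↔ (i : ℕ) ≤ (j : ℕ)
        by_cases hij : (i : ℕ) ≤ (j : ℕ)
        · exact iff_of_true (h3 i j hij j.2 _ (hf j y)) hij
        · exact iff_of_false (hR.asymm (h4 i j (by omega) (by omega) _ (hf j y))) hij
      · change R (v i) (v j) ↔ j < i
        rcases lt_trichotomy i j with hij | rfl | hij
        · exact iff_of_false (hR.asymm (h1 i j hij (by omega))) hij.not_gt
        · exact iff_of_false (hR.irrefl _) (lt_irrefl _)
        · exact iff_of_true (h1 j i hij (by omega)) hij

theorem Copy.ap (h : Copy R (Tournament.A n) X) : Ap R n X := by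
  induction n generalizing X with
  | zero => trivial
  | succ n ih =>
    obtain ⟨f, hf, hfR⟩ := h
    let c : Fin n → (Tournament.A n).Vert → (Tournament.A (n + 1)).Vert := fun i x => Sum.inl (i, x)
    let w : Fin (n + 1) → (Tournament.A (n + 1)).Vert := Sum.inr
    have hw : ∀ i (hi : i ≤ n), Fin.ofNat (n + 1) i = ⟨i, Nat.lt_succ_of_le hi⟩ := fun i hi =>
      Fin.ext (Nat.mod_eq_of_lt (Nat.lt_succ_of_le hi))
    have hmem : ∀ i y, y ∈ X.filter (fun y => ∃ (hi : i < n) (x : _), f (c ⟨i, hi⟩ x) = y) ↔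
        ∃ (hi : i < n) (x : _), f (c ⟨i, hi⟩ x) = y := fun i y => by
      rw [Finset.mem_filter]
      refine ⟨fun h => h.2, fun h => ⟨?_, h⟩⟩
      obtain ⟨hi, x, rfl⟩ := h
      exact hf _
    refine ⟨fun i => f (w (Fin.ofNat (n + 1) i)),
      fun i => X.filter fun y => ∃ (hi : i < n) (x : _), f (c ⟨i, hi⟩ x) = y, fun i _ => hf _,
      fun i hi => ⟨Finset.filter_subset _ _, ih ⟨f ∘ c ⟨i, hi⟩,
        fun x => (hmem _ _).2 ⟨hi, x, rfl⟩, fun x y => ?_⟩⟩, fun i j hij hj => ?_,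
      fun i j hij hj x hx y hy => ?_, fun i j hij hj y hy => ?_, fun i j hji hi y hy => ?_⟩
    · refine (hfR _ _).trans ?_
      change ((⟨i, hi⟩ : Fin n) < ⟨i, hi⟩ ∨ (_ = _ ∧ (Tournament.A n).graph.Adj x y)) ↔ _
      simp
    · dsimp only
      rw [hw i (by omega), hw j hj]
      exact (hfR _ _).2 hij
    · obtain ⟨hi, x, rfl⟩ := (hmem _ _).1 hx
      obtain ⟨hj, y, rfl⟩ := (hmem _ _).1 hy
      exact (hfR _ _).2 (Or.inl hij)
    · obtain ⟨hj, y, rfl⟩ := (hmem _ _).1 hy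
      dsimp only
      rw [hw i (by omega)]
      exact (hfR _ _).2 hij
    · obtain ⟨hj, y, rfl⟩ := (hmem _ _).1 hy
      dsimp only
      rw [hw i hi]
      exact (hfR _ _).2 hji

end Copy

theorem isTour (T : Tournament.{u}) : IsTour T.graph.Adj :=
  ⟨T.isTournament.loopless, T.isTournament.exactly_one⟩

/-- A subtournament of a tournament with a copy in `T` is a subtournament of `T`. -/
theorem Copy.isSubtournament {S : Tournament.{u}} {S' : Tournament.{v}} {T : Tournament.{u}}
    {X : Finset T.Vert} (h : Copy T.graph.Adj S' X) (hS : S.IsSubtournament S') :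
    S.IsSubtournament T := by
  obtain ⟨f, -, hf⟩ := h
  obtain ⟨g, hg⟩ := hS
  refine ⟨⟨f ∘ g, fun x y hxy => ?_⟩, fun x y => (hf _ _).trans (hg _ _)⟩
  by_contra hne
  have hxy' : f (g x) = f (g y) := hxy
  have h1 := (hf (g x) (g y)).trans (hg x y)
  have h2 := (hf (g y) (g x)).trans (hg y x)
  rw [hxy'] at h1 h2
  have h3 := S.isTournament.exactly_one x y hne
  have := T.isTournament.loopless (f (g y))
  tauto

/-- The total orders in the definition of the clique number correspond to injective rankings. -/
theorem cliqueNumber_le_iff (T : Tournament.{u}) [Fintype T.Vert] (c : ℕ) :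
    T.cliqueNumber ≤ c ↔ Le T.graph.Adj Finset.univ c := by
  constructor
  · intro h
    have hne :
        {k : ℕ | ∃ L : LinearOrder T.Vert, (T.graph.backedgeGraph L).cliqueNum = k}.Nonempty :=
      ⟨_, LinearOrder.lift' (Fintype.equivFin T.Vert) (Fintype.equivFin T.Vert).injective, rfl⟩
    obtain ⟨L, hL⟩ := Nat.sInf_mem hne
    have hρ : ∀ x y, L.lt x y → (Finset.univ.filter (L.lt · x)).card <
        (Finset.univ.filter (L.lt · y)).card := fun x y hxy => by
      refine Finset.card_lt_card ⟨fun z hz => ?_, fun hsub => ?_⟩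
      · rw [Finset.mem_filter] at hz ⊢
        exact ⟨hz.1, lt_trans hz.2 hxy⟩
      · have := hsub (Finset.mem_filter.2 ⟨Finset.mem_univ x, hxy⟩)
        exact lt_irrefl x (Finset.mem_filter.1 this).2
    refine ⟨fun x => (Finset.univ.filter (L.lt · x)).card, fun x _ y _ hxy => ?_, fun K _ hK => ?_⟩
    · rcases lt_trichotomy x y with h | h | h
      · exact ((hρ x y h).ne hxy).elim
      · exact h
      · exact ((hρ y x h).ne hxy.symm).elim
    · have hcl : (T.graph.backedgeGraph L).IsClique K := by
        intro x hx y hy hne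
        rcases lt_or_gt_of_ne hne with h | h
        · exact Or.inl ⟨h, hK x hx y hy (hρ x y h)⟩
        · exact Or.inr ⟨h, hK y hy x hx (hρ y x h)⟩
      have := hcl.card_le_cliqueNum
      rw [hL] at this
      exact this.trans h
  · rintro ⟨ρ, hi, hρ⟩
    let L : LinearOrder T.Vert := LinearOrder.lift' ρ fun x y hxy => hi (by simp) (by simp) hxy
    have hle : T.cliqueNumber ≤ (T.graph.backedgeGraph L).cliqueNum := Nat.sInf_le ⟨L, rfl⟩
    refine hle.trans ?_
    obtain ⟨K, hK⟩ := (T.graph.backedgeGraph L).exists_isNClique_cliqueNum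
    rw [← hK.card_eq]
    refine hρ K (Finset.subset_univ _) fun x hx y hy hxy => ?_
    have hne : x ≠ y := by
      rintro rfl
      exact lt_irrefl _ hxy
    rcases hK.isClique hx hy hne with h | h
    · exact h.2
    · exact (lt_asymm hxy h.1).elim

/-- A copy of the tournament `T` in the universe `u`. -/
def lift (T : Tournament.{0}) : Tournament.{u} where
  Vert := ULift.{u} T.Vert
  finite_vert := by
    have := T.finite_vert
    infer_instance
  graph := ⟨fun x y => T.graph.Adj x.down y.down⟩
  isTournament := ⟨fun x => T.isTournament.loopless x.down, fun x y h =>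
    T.isTournament.exactly_one x.down y.down fun e => h (ULift.ext _ _ e)⟩

/-- If every `H`-free tournament has clique number at most `c` and `T` has larger clique number,
then `H` contains a subtournament of `T`. -/
theorem exists_isSubtournament {H : Set Tournament.{u}} {c : ℕ}
    (hc : ∀ T : Tournament.{u}, T.IsFree H → T.cliqueNumber ≤ c) (T : Tournament.{0})
    (hT : ∀ {V : Type u} {R : V → V → Prop} {X : Finset V}, IsTour R → Copy R T X → ¬ Le R X c) :
    ∃ S ∈ H, S.IsSubtournament T := by
  by_contra! hcon
  have hfree : (lift.{u} T).IsFree H := fun S hS ⟨f, hf⟩ =>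
    hcon S hS ⟨f.trans Equiv.ulift.toEmbedding, hf⟩
  have hfin := (lift.{u} T).finite_vert
  let _ := Fintype.ofFinite (lift.{u} T).Vert
  exact hT (isTour _) ⟨ULift.up, fun _ => Finset.mem_univ _, fun _ _ => Iff.rfl⟩
    ((cliqueNumber_le_iff _ c).1 (hc _ hfree))

end TournamentClique

theorem mainTheorem2 (H : Set Tournament.{u}) :
    (∃ c : ℕ, ∀ T : Tournament.{u}, T.IsFree H → T.cliqueNumber ≤ c) ↔
      ∃ n : ℕ, 1 ≤ n ∧
        (∃ S ∈ H, S.IsSubtournament (Tournament.A n)) ∧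
        (∃ S ∈ H, S.IsSubtournament (Tournament.D n)) := by
  constructor
  · rintro ⟨c, hc⟩
    have hpow : c + 1 < 2 ^ (c + 1) := Nat.lt_two_pow_self
    exact ⟨2 ^ (c + 1) - 1, by omega,
      TournamentClique.exists_isSubtournament hc _ fun hR h => h.ap.not_le hR,
      TournamentClique.exists_isSubtournament hc _ fun hR h => h.dp.not_le hR⟩
  · rintro ⟨n, -, ⟨S₁, hS₁, h₁⟩, S₂, hS₂, h₂⟩
    obtain ⟨C, hC⟩ := TournamentClique.exists_bound.{u} n n
    refine ⟨C, fun T hT => ?_⟩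
    have hfin := T.finite_vert
    let _ := Fintype.ofFinite T.Vert
    have hR := TournamentClique.isTour T
    exact (TournamentClique.cliqueNumber_le_iff T C).2 (hC T.Vert T.graph.Adj Finset.univ hR
      (fun h => hT S₂ hS₂ ((h.copy hR).isSubtournament h₂))
      fun h => hT S₁ hS₁ ((h.copy hR).isSubtournament h₁))
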